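/- Let $\mathfrak{su}(2)$ have generators $\mathfrak s^1,\mathfrak s^2,\mathfrak s^3$ with $[\mathfrak s^\alpha,\mathfrak s^\beta]=i\epsilon_{\alpha\beta\gamma}\mathfrak s^\gamma$, and let $V$ be its irreducible complex representation of dimension $4$ (spin $\tfrac32$). On $V\otimes V\otimes V$ write $s_a^\alpha$ for the action of $\mathfrak s^\alpha$ on the $a$-th factor, and put $$K_{12}=\sum_{\alpha=1}^3(s_1^\alpha+s_2^\alpha)^2,\qquad K_{23}=\sum_{\alpha=1}^3(s_2^\alpha+s_3^\alpha)^2,\qquad K_{123}=\sum_{\alpha=1}^3(s_1^\alpha+s_2^\alpha+s_3^\alpha)^2 .$$ Let $\mathcal C_{\frac32,\frac32,\frac32}\subset \mathrm{End}(V\otimes V\otimes V)$ be the algebra of all endomorphisms commuting with $s_1^\alpha+s_2^\alpha+s_3^\alpha$ for $\alpha=1,2,3$. Let $\mathcal R$ be the universal Racah algebra: the unital associative $\mathbb C$-algebra generated by $A$, $B$ and central elements $C,\alpha_1,\alpha_2,\alpha_3$ subject to $$[B,[A,B]]=-2B^2-2\{A,B\}+2(C+\alpha_1+\alpha_2+\alpha_3)B+2(\alpha_1-C)(\alpha_3-\alpha_2),$$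 $$[A,[B,A]]=-2A^2-2\{A,B\}+2(C+\alpha_1+\alpha_2+\alpha_3)A+2(\alpha_1-\alpha_2)(\alpha_3-C),$$ where $[x,y]=xy-yx$ and $\{x,y\}=xy+yx$. Put $\mathcal J=\{0,1,2,3\}$ and $\mathcal J_{123}=\{\tfrac12,\tfrac32,\tfrac52,\tfrac72,\tfrac92\}$ (the spins occurring in $V\otimes V$ and in $V\otimes V\otimes V$), and $$\mathcal M=\{\ell(\ell+1)-k(k+1)\;:\;k\in\mathcal J,\ \ell\in\{|k-\tfrac32|,|k-\tfrac32|+1,\dots,k+\tfrac32\}\}.$$ Let $\overline{\mathcal R}=\overline{\mathcal R}(\tfrac{15}4,\tfrac{15}4,\tfrac{15}4)$ be the quotient of $\mathcal R$ by the relations $\alpha_1=\alpha_2=\alpha_3=\tfrac{15}4$ and $$\prod_{j\in\mathcal J}(A-j(j+1))=0,\quad \prod_{j\in\mathcal J}(B-j(j+1))=0,\quad \prod_{j\in\mathcal J_{123}}(C-j(j+1))=0,$$ $$\prod_{j\in\mathcal J}(C-A-B+\alpha_1+\alpha_2+\alpha_3-j(j+1))=0,\quad \prod_{m\in\mathcal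 M}(A+B-\alpha_1-\alpha_2-\alpha_3-m)=0,$$ $$\prod_{m\in\mathcal M}(C-A-m)=0,\quad \prod_{m\in\mathcal M}(C-B-m)=0 .$$ **Theorem.** There is an isomorphism of $\mathbb C$-algebras $\overline\phi:\overline{\mathcal R}\to\mathcal C_{\frac32,\frac32,\frac32}$ with $\overline\phi(A)=K_{12}$, $\overline\phi(B)=K_{23}$ and $\overline\phi(C)=K_{123}$; in particular $\dim\overline{\mathcal R}=34$. Moreover, the element $G=C+\tfrac14$ of $\overline{\mathcal R}$ is central, the canonical map $$\overline{\mathcal R}\longrightarrow\prod_{g\in\{25,16,9,4,1\}}\overline{\mathcal R}/(G-g)$$ is bijective, and the quotients $\overline{\mathcal R}/(G-g)$ for $g=25,16,9,4,1$ have dimensions $1,4,9,16,4$ respectively. -/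

import Mathlib

open scoped Kronecker

namespace Racah

/-! Spins are recorded by their doubles: `n : ℕ` stands for the spin `n / 2`. -/

noncomputable section SpinRepresentation

/-- Raising operator of the irreducible representation of dimension `n + 1`, in the monomial basis
`e_k = x ^ (n - k) * y ^ k` of binary forms of degree `n`: `e_k ↦ k • e_{k-1}`. -/
def raising (n : ℕ) : Matrix (Fin (n + 1)) (Fin (n + 1)) ℂ :=
  Matrix.of fun i k => if (i : ℕ) + 1 = (k : ℕ) then ((k : ℕ) : ℂ) else 0

/-- Lowering operator: `e_k ↦ (n - k) • e_{k+1}`. -/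
def lowering (n : ℕ) : Matrix (Fin (n + 1)) (Fin (n + 1)) ℂ :=
  Matrix.of fun i k => if (i : ℕ) = (k : ℕ) + 1 then (n : ℂ) - ((k : ℕ) : ℂ) else 0

/-- Weight operator: `e_k ↦ (n - 2 * k) • e_k`. -/
def weight (n : ℕ) : Matrix (Fin (n + 1)) (Fin (n + 1)) ℂ :=
  Matrix.diagonal fun k => (n : ℂ) - 2 * ((k : ℕ) : ℂ)

/-- The images `s^1, s^2, s^3` (indexed by `0, 1, 2`) of the generators of `su(2)` in the
spin-`n/2` representation; they satisfy `[s^a, s^b] = i ε_{abc} s^c`. -/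
def spin (n : ℕ) : Fin 3 → Matrix (Fin (n + 1)) (Fin (n + 1)) ℂ :=
  ![(1 / 2 : ℂ) • (raising n + lowering n),
    (-Complex.I / 2) • (raising n - lowering n),
    (1 / 2 : ℂ) • weight n]

/-- Endomorphisms of the threefold tensor product, as matrices in the product basis. -/
abbrev EndTensor (n₁ n₂ n₃ : ℕ) : Type :=
  Matrix (Fin (n₁ + 1) × Fin (n₂ + 1) × Fin (n₃ + 1))
    (Fin (n₁ + 1) × Fin (n₂ + 1) × Fin (n₃ + 1)) ℂ

/-- `s₁ ⊗ 1 ⊗ 1`. -/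
def spin₁ (n₁ n₂ n₃ : ℕ) (a : Fin 3) : EndTensor n₁ n₂ n₃ :=
  spin n₁ a ⊗ₖ ((1 : Matrix (Fin (n₂ + 1)) (Fin (n₂ + 1)) ℂ) ⊗ₖ
    (1 : Matrix (Fin (n₃ + 1)) (Fin (n₃ + 1)) ℂ))

/-- `1 ⊗ s₂ ⊗ 1`. -/
def spin₂ (n₁ n₂ n₃ : ℕ) (a : Fin 3) : EndTensor n₁ n₂ n₃ :=
  (1 : Matrix (Fin (n₁ + 1)) (Fin (n₁ + 1)) ℂ) ⊗ₖ (spin n₂ a ⊗ₖ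
    (1 : Matrix (Fin (n₃ + 1)) (Fin (n₃ + 1)) ℂ))

/-- `1 ⊗ 1 ⊗ s₃`. -/
def spin₃ (n₁ n₂ n₃ : ℕ) (a : Fin 3) : EndTensor n₁ n₂ n₃ :=
  (1 : Matrix (Fin (n₁ + 1)) (Fin (n₁ + 1)) ℂ) ⊗ₖ
    ((1 : Matrix (Fin (n₂ + 1)) (Fin (n₂ + 1)) ℂ) ⊗ₖ spin n₃ a)

/-- The intermediate Casimir `K₁₂`. -/
def K₁₂ (n₁ n₂ n₃ : ℕ) : EndTensor n₁ n₂ n₃ :=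
  ∑ a : Fin 3, (spin₁ n₁ n₂ n₃ a + spin₂ n₁ n₂ n₃ a) ^ 2

/-- The intermediate Casimir `K₂₃`. -/
def K₂₃ (n₁ n₂ n₃ : ℕ) : EndTensor n₁ n₂ n₃ :=
  ∑ a : Fin 3, (spin₂ n₁ n₂ n₃ a + spin₃ n₁ n₂ n₃ a) ^ 2

/-- The total Casimir `K₁₂₃`. -/
def K₁₂₃ (n₁ n₂ n₃ : ℕ) : EndTensor n₁ n₂ n₃ :=
  ∑ a : Fin 3, (spin₁ n₁ n₂ n₃ a + spin₂ n₁ n₂ n₃ a + spin₃ n₁ n₂ n₃ a) ^ 2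

/-- The centralizer of the diagonal action of `su(2)` on the threefold tensor product. -/
def spinCentralizer (n₁ n₂ n₃ : ℕ) : Subalgebra ℂ (EndTensor n₁ n₂ n₃) :=
  Subalgebra.centralizer ℂ
    (Set.range fun a : Fin 3 => spin₁ n₁ n₂ n₃ a + spin₂ n₁ n₂ n₃ a + spin₃ n₁ n₂ n₃ a)

end SpinRepresentation

section Spectra

/-- The Casimir eigenvalue `j (j + 1)` of the spin `j = n / 2`. -/
def cas (n : ℕ) : ℚ := (n / 2 : ℚ) * (n / 2 + 1)

/-- Doubled spins `2j` with `j ∈ {|a - b|/2, |a - b|/2 + 1, …, (a + b)/2}`: the constituents of the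
tensor product of the representations of spins `a/2` and `b/2`. -/
def J (a b : ℕ) : Finset ℕ :=
  (Finset.Icc (max a b - min a b) (a + b)).filter fun l => l % 2 = (a + b) % 2

/-- Doubled spins in the bottom row of the Bratteli diagram: the constituents of the threefold
tensor product. -/
def J₃ (a b c : ℕ) : Finset ℕ := (J a b).biUnion fun k => J k c

/-- The differences `ℓ(ℓ+1) - k(k+1)` along the edges `(k, ℓ)` from the second to the third row of
the Bratteli diagram of the (ordered) triple of spins `a/2, b/2, c/2`. -/
def M (a b c : ℕ) : Finset ℚ :=
  (J a b).biUnion fun k => (J k c).image fun l => cas l - cas k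

end Spectra

noncomputable section RacahAlgebra

/-- `∏_{m ∈ S} (x - m)`. -/
def prodShift {R : Type*} [Ring R] [Algebra ℂ R] (S : Finset ℚ) (x : R) : R :=
  Polynomial.aeval x (∏ m ∈ S, (Polynomial.X - Polynomial.C (m : ℂ)))

/-- Generators of the universal Racah algebra. -/
inductive Gen : Type
  | A | B | C
  | α (i : Fin 3)

/-- The free algebra on the generators. -/
abbrev Free : Type := FreeAlgebra ℂ Gen

namespace Free

abbrev A : Free := FreeAlgebra.ι ℂ Gen.A
abbrev B : Free := FreeAlgebra.ι ℂ Gen.B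
abbrev C : Free := FreeAlgebra.ι ℂ Gen.C
abbrev α₁ : Free := FreeAlgebra.ι ℂ (Gen.α 0)
abbrev α₂ : Free := FreeAlgebra.ι ℂ (Gen.α 1)
abbrev α₃ : Free := FreeAlgebra.ι ℂ (Gen.α 2)

end Free

open Free in
/-- Defining relations of the universal Racah algebra; `⁅x, y⁆ = x * y - y * x`. -/
inductive UnivRel : Free → Free → Prop
  | central_C (g : Gen) :
      UnivRel (C * FreeAlgebra.ι ℂ g) (FreeAlgebra.ι ℂ g * C)
  | central_α (i : Fin 3) (g : Gen) :
      UnivRel (FreeAlgebra.ι ℂ (Gen.α i) * FreeAlgebra.ι ℂ g)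
        (FreeAlgebra.ι ℂ g * FreeAlgebra.ι ℂ (Gen.α i))
  | rel_B : UnivRel ⁅B, ⁅A, B⁆⁆
      (-2 * B ^ 2 - 2 * (A * B + B * A) + 2 * (C + α₁ + α₂ + α₃) * B
        + 2 * (α₁ - C) * (α₃ - α₂))
  | rel_A : UnivRel ⁅A, ⁅B, A⁆⁆
      (-2 * A ^ 2 - 2 * (A * B + B * A) + 2 * (C + α₁ + α₂ + α₃) * A
        + 2 * (α₁ - α₂) * (α₃ - C))

/-- The universal Racah algebra. -/
abbrev Univ : Type := RingQuot UnivRel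

namespace Univ

def mk : Free →ₐ[ℂ] Univ := RingQuot.mkAlgHom ℂ UnivRel

def A : Univ := mk Free.A
def B : Univ := mk Free.B
def C : Univ := mk Free.C
def α (i : Fin 3) : Univ := mk (FreeAlgebra.ι ℂ (Gen.α i))

end Univ

open Univ in
/-- Additional relations defining the quotiented Racah algebra attached to the spins
`n₁/2, n₂/2, n₃/2`. -/
inductive QuotRel (n₁ n₂ n₃ : ℕ) : Univ → Univ → Prop
  | α (i : Fin 3) :
      QuotRel n₁ n₂ n₃ (α i) (algebraMap ℂ Univ ((cas (![n₁, n₂, n₃] i) : ℚ) : ℂ))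
  | A : QuotRel n₁ n₂ n₃ (prodShift ((J n₁ n₂).image cas) A) 0
  | B : QuotRel n₁ n₂ n₃ (prodShift ((J n₂ n₃).image cas) B) 0
  | C : QuotRel n₁ n₂ n₃ (prodShift ((J₃ n₁ n₂ n₃).image cas) C) 0
  | CAB : QuotRel n₁ n₂ n₃
      (prodShift ((J n₁ n₃).image cas) (C - A - B + α 0 + α 1 + α 2)) 0
  | AB : QuotRel n₁ n₂ n₃ (prodShift (M n₁ n₃ n₂) (A + B - α 0 - α 1 - α 2)) 0
  | CA : QuotRel n₁ n₂ n₃ (prodShift (M n₁ n₂ n₃) (C - A)) 0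
  | CB : QuotRel n₁ n₂ n₃ (prodShift (M n₂ n₃ n₁) (C - B)) 0

/-- The quotiented Racah algebra attached to the spins `n₁/2, n₂/2, n₃/2`. -/
abbrev Bar (n₁ n₂ n₃ : ℕ) : Type := RingQuot (QuotRel n₁ n₂ n₃)

namespace Bar

def mk (n₁ n₂ n₃ : ℕ) : Univ →ₐ[ℂ] Bar n₁ n₂ n₃ := RingQuot.mkAlgHom ℂ (QuotRel n₁ n₂ n₃)

variable {n₁ n₂ n₃ : ℕ}

def A : Bar n₁ n₂ n₃ := mk n₁ n₂ n₃ Univ.A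
def B : Bar n₁ n₂ n₃ := mk n₁ n₂ n₃ Univ.B
def C : Bar n₁ n₂ n₃ := mk n₁ n₂ n₃ Univ.C

/-- The central element `G = C + 1/4`. -/
def G : Bar n₁ n₂ n₃ := C + algebraMap ℂ (Bar n₁ n₂ n₃) (1 / 4)

end Bar

/-- The relation `G = g` with `g` a number. -/
inductive BlockRel (n₁ n₂ n₃ : ℕ) (g : ℂ) : Bar n₁ n₂ n₃ → Bar n₁ n₂ n₃ → Prop
  | G : BlockRel n₁ n₂ n₃ g Bar.G (algebraMap ℂ (Bar n₁ n₂ n₃) g)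

/-- The quotient of the quotiented Racah algebra by the relation `G = g`. -/
abbrev Block (n₁ n₂ n₃ : ℕ) (g : ℂ) : Type := RingQuot (BlockRel n₁ n₂ n₃ g)

/-- The projection onto the quotient by `G = g`. -/
def Block.mk (n₁ n₂ n₃ : ℕ) (g : ℂ) : Bar n₁ n₂ n₃ →ₐ[ℂ] Block n₁ n₂ n₃ g :=
  RingQuot.mkAlgHom ℂ (BlockRel n₁ n₂ n₃ g)

end RacahAlgebra

end Racah

/-! Both algebras are identified with the product of the matrix algebras of sizes 1, 2, 3, 4, 2, one
factor for each total spin 9/2, 7/2, 5/2, 3/2, 1/2. The identifications send `A` and `K₁₂` to the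
same diagonal matrices, and `B` and `K₂₃` to the same tridiagonal ones.

Racah side. The central element `C` is a root of a squarefree polynomial, so the algebra is the
product of its quotients at the five values of `C` (`mk_blocks_bijective`). In one quotient let `E
k` be the spectral projections of `A`, for k = 0, 1, 2, 3. The polynomial in `C - A` kills every `E
k` whose spin k cannot be coupled to the given total spin (`spinProj_eq_zero`). Compressing the
relation for [A,[B,A]] between `E i` and `E j` shows that `B` is tridiagonal, with scalar diagonal
corners except possibly at spin 0. Compressing the relation for [B,[A,B]] links the two closed walks
`E i B E (i+1) B E i` and `E i B E (i-1) B E i`. Together these force all the closed walks to be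
scalars (`isScalar`). Only for total spin 3/2, where spin 0 survives, are the polynomials of `B` and
of `C - A - B + α₁ + α₂ + α₃` needed for this. An algebra of this shape with d surviving projections
is spanned by d² words (`IsTridiagonal.span_eq_top`). Explicit d × d matrices satisfy all the
relations and generate the full matrix algebra, so the quotient is that matrix algebra
(`blockRep_bijective`).

Tensor side. A table of highest weight vectors, on which `K₁₂` and `K₂₃` act by exactly those
explicit matrices, yields a basis of the tensor product by lowering. An endomorphism commuting with
the diagonal action is then an arbitrary family of matrices on the spaces of highest weight vectors
(`centralizerEquiv`). -/

namespace Racah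

/-! ### Spectral projections by Lagrange interpolation. -/

section EigenProjections

open Polynomial

variable {R : Type*} [Ring R] [Algebra ℂ R]

theorem aeval_mul_of_mul_eq_smul {x e : R} {c : ℂ} (h : x * e = c • e) (p : ℂ[X]) :
    aeval x p * e = p.eval c • e := by
  induction p using Polynomial.induction_on' with
  | add p q hp hq => rw [map_add, add_mul, hp, hq, eval_add, add_smul]
  | monomial n r =>
    have hn : ∀ n : ℕ, x ^ n * e = c ^ n • e := by
      intro n
      induction n with
      | zero => simp
      | succ n ih => rw [pow_succ', mul_assoc, ih, mul_smul_comm, h, smul_smul, pow_succ]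
    rw [aeval_monomial, mul_assoc, hn, eval_monomial, ← Algebra.smul_def, smul_smul]

theorem aeval_eq_zero_of_eval_eq_zero {ι : Type*} {s : Finset ι} {v : ι → ℂ}
    (hv : Set.InjOn v s) {x : R} (hx : aeval x (∏ i ∈ s, (X - C (v i))) = 0) {p : ℂ[X]}
    (hp : ∀ i ∈ s, p.eval (v i) = 0) : aeval x p = 0 := by
  have : (∏ i ∈ s, (X - C (v i))) ∣ p := by
    refine Finset.prod_dvd_of_coprime (fun i hi j hj hij => ?_) fun i hi =>
      dvd_iff_isRoot.2 (hp i hi)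
    exact isCoprime_X_sub_C_of_isUnit_sub (sub_ne_zero.2 fun h => hij (hv hi hj h)).isUnit
  obtain ⟨q, rfl⟩ := this
  rw [map_mul, hx, zero_mul]

/-- The projection onto the `v i`-eigenspace of an element annihilated by `∏ i ∈ s, (X - v i)`. -/
noncomputable def eigenProj {ι : Type*} [DecidableEq ι] (s : Finset ι) (v : ι → ℂ) (x : R) (i : ι) :
    R :=
  aeval x (Lagrange.basis s v i)

section

variable {ι : Type*} [DecidableEq ι] {s : Finset ι} {v : ι → ℂ} {x : R}

theorem map_eigenProj {R' : Type*} [Ring R'] [Algebra ℂ R'] (f : R →ₐ[ℂ] R') (i : ι) :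
    f (eigenProj s v x i) = eigenProj s v (f x) i :=
  (aeval_algHom_apply f x _).symm

theorem eigenProj_comm {y : R} (h : Commute x y) (i : ι) : Commute (eigenProj s v x i) y := by
  have h1 : x ∈ Subalgebra.centralizer ℂ {y} := by
    rw [Subalgebra.mem_centralizer_iff]; rintro _ rfl; exact h.symm.eq
  have h2 : eigenProj s v x i ∈ Subalgebra.centralizer ℂ {y} := by
    exact Algebra.adjoin_le (Set.singleton_subset_iff.2 h1) (aeval_mem_adjoin_singleton ℂ x)
  rw [Subalgebra.mem_centralizer_iff] at h2
  exact (h2 y rfl).symm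

variable (hv : Set.InjOn v s) (hx : aeval x (∏ i ∈ s, (X - C (v i))) = 0)
include hv

theorem eigenProj_mul_of_eq_smul {e : R} {i j : ι} (hi : i ∈ s) (hj : j ∈ s)
    (h : x * e = v j • e) : eigenProj s v x i * e = if i = j then e else 0 := by
  rw [eigenProj, aeval_mul_of_mul_eq_smul h]
  split_ifs with hij
  · subst hij; rw [Lagrange.eval_basis_self hv hi, one_smul]
  · rw [Lagrange.eval_basis_of_ne hij hj, zero_smul]

theorem eigenProj_algebraMap {i j : ι} (hi : i ∈ s) (hj : j ∈ s) :
    eigenProj s v (algebraMap ℂ R (v j)) i = if i = j then 1 else 0 := by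
  simpa using eigenProj_mul_of_eq_smul (x := algebraMap ℂ R (v j)) hv hi hj (e := 1)
    (by rw [mul_one, Algebra.algebraMap_eq_smul_one])

include hx

theorem mul_eigenProj (i : ι) : x * eigenProj s v x i = v i • eigenProj s v x i := by
  have := aeval_eq_zero_of_eval_eq_zero hv hx (p := (X - C (v i)) * Lagrange.basis s v i) (by
    intro j hj
    rcases eq_or_ne i j with rfl | hij
    · simp
    · rw [eval_mul, Lagrange.eval_basis_of_ne hij hj, mul_zero])
  rw [map_mul, map_sub, aeval_X, aeval_C, sub_mul, sub_eq_zero] at this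
  rw [eigenProj, this, Algebra.smul_def]

theorem eigenProj_mul_right (i : ι) :
    eigenProj s v x i * x = v i • eigenProj s v x i := by
  rw [← mul_eigenProj hv hx i]; exact eigenProj_comm (Commute.refl x) i

theorem eigenProj_mul_eigenProj {i j : ι} (hi : i ∈ s) (hj : j ∈ s) :
    eigenProj s v x i * eigenProj s v x j = if i = j then eigenProj s v x i else 0 := by
  rw [eigenProj_mul_of_eq_smul hv hi hj (mul_eigenProj hv hx j)]
  split_ifs with h <;> simp [h]

omit hx in
theorem sum_eigenProj (hs : s.Nonempty) : ∑ i ∈ s, eigenProj s v x i = 1 := by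
  simp_rw [eigenProj]
  rw [← map_sum, Lagrange.sum_basis hv hs, map_one]

end

theorem prodShift_mul {x e : R} {c : ℂ} (h : x * e = c • e) (S : Finset ℚ) :
    prodShift S x * e = (∏ m ∈ S, (c - (m : ℂ))) • e := by
  rw [prodShift, aeval_mul_of_mul_eq_smul h, eval_prod]
  simp

theorem map_prodShift {R' : Type*} [Ring R'] [Algebra ℂ R'] (f : R →ₐ[ℂ] R') (S : Finset ℚ)
    (x : R) : f (prodShift S x) = prodShift S (f x) :=
  (aeval_algHom_apply f x _).symm

theorem prodShift_eq_zero_of_subset {S T : Finset ℚ} (h : S ⊆ T) {x : R}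
    (hx : prodShift S x = 0) : prodShift T x = 0 := by
  rw [prodShift, ← Finset.prod_sdiff h, map_mul]
  rw [prodShift] at hx
  rw [hx, mul_zero]

/-- The polynomial acts on `e` by its value at `q`, which is nonzero. This is how a polynomial
relation rules out an eigenvalue. -/
theorem eq_zero_of_prodShift_eq_zero {S : Finset ℚ} {x e : R} (hx : prodShift S x = 0) {q : ℚ}
    (hq : q ∉ S) (h : x * e = (q : ℂ) • e) : e = 0 := by
  have := prodShift_mul h S
  rw [hx, zero_mul, eq_comm, smul_eq_zero, Finset.prod_eq_zero_iff] at this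
  refine this.resolve_left ?_
  rintro ⟨m, hm, h0⟩
  rw [sub_eq_zero, Rat.cast_inj] at h0
  exact hq (h0 ▸ hm)

end EigenProjections

/-! ### Algebras generated by a diagonal and an irreducible tridiagonal element. -/

section Tridiagonal

variable {R : Type*} [Ring R] [Algebra ℂ R]

/-- The product `E i * B * E (i - 1) * ⋯ * B * E 0`. -/
def descend (B : R) (E : ℕ → R) : ℕ → R
  | 0 => E 0
  | i + 1 => E (i + 1) * B * descend B E i

/-- The product `E 0 * B * E 1 * ⋯ * B * E j`. -/
def ascend (B : R) (E : ℕ → R) : ℕ → R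
  | 0 => E 0
  | j + 1 => ascend B E j * B * E (j + 1)

/-- `B` acts as an irreducible tridiagonal matrix with respect to the orthogonal idempotents
`E 0, …, E (d - 1)`, and `A` acts diagonally. -/
structure IsTridiagonal (A B : R) (d : ℕ) (E : ℕ → R) (a b s : ℕ → ℂ) : Prop where
  adjoin : Algebra.adjoin ℂ {A, B} = ⊤
  idem : ∀ i, E i * E i = E i
  zero : ∀ i, d ≤ i → E i = 0
  sum : ∑ i ∈ Finset.range d, E i = 1
  mul_left : ∀ i, A * E i = a i • E i
  zero_col : B * E 0 = b 0 • E 0 + E 1 * B * E 0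
  succ_col : ∀ i, B * E (i + 1) =
    E i * B * E (i + 1) + b (i + 1) • E (i + 1) + E (i + 2) * B * E (i + 1)
  up_down : ∀ i, E i * B * E (i + 1) * B * E i = s i • E i
  down_up : ∀ i, E (i + 1) * B * E i * B * E (i + 1) = s i • E (i + 1)
  ne_zero : ∀ i, i + 1 < d → s i ≠ 0

namespace IsTridiagonal

variable {A B : R} {d : ℕ} {E : ℕ → R} {a b s : ℕ → ℂ} (h : IsTridiagonal A B d E a b s)
include h

theorem mul_descend (i : ℕ) : E i * descend B E i = descend B E i := by
  cases i with
  | zero => exact h.idem 0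
  | succ i => simp only [descend, ← mul_assoc, h.idem]

theorem descend_eq_zero {i : ℕ} (hi : d ≤ i) : descend B E i = 0 := by
  rw [← h.mul_descend, h.zero i hi, zero_mul]

theorem A_mul_descend (i : ℕ) : A * descend B E i = a i • descend B E i := by
  rw [← h.mul_descend, ← mul_assoc, h.mul_left, smul_mul_assoc]

theorem B_mul_descend_zero :
    B * descend B E 0 = b 0 • descend B E 0 + descend B E 1 := by
  simp only [descend]
  rw [h.zero_col]

theorem B_mul_descend_succ (i : ℕ) :
    B * descend B E (i + 1) = s i • descend B E i + b (i + 1) • descend B E (i + 1)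
      + descend B E (i + 2) := by
  have h1 : B * descend B E (i + 1) = B * E (i + 1) * descend B E (i + 1) := by
    rw [mul_assoc, h.mul_descend]
  have h2 : E i * B * E (i + 1) * descend B E (i + 1) = s i • descend B E i := by
    rw [descend, ← h.mul_descend i]
    simp only [← mul_assoc]
    rw [mul_assoc _ (E (i+1)) (E (i+1)), h.idem, h.up_down, smul_mul_assoc]
  have h3 : E (i + 2) * B * E (i + 1) * descend B E (i + 1) = descend B E (i + 2) := by
    rw [mul_assoc, h.mul_descend]; rfl
  rw [h1, h.succ_col, add_mul, add_mul, h2, h3, smul_mul_assoc, h.mul_descend]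

theorem descend_mul_ascend (i : ℕ) :
    descend B E i * ascend B E i = (∏ j ∈ Finset.range i, s j) • E i := by
  induction i with
  | zero => simp [descend, ascend, h.idem]
  | succ i ih =>
    have : descend B E (i + 1) * ascend B E (i + 1)
        = E (i + 1) * B * (descend B E i * ascend B E i) * B * E (i + 1) := by
      simp only [descend, ascend, mul_assoc]
    rw [this, ih, mul_smul_comm, smul_mul_assoc, smul_mul_assoc, h.down_up, smul_smul,
      Finset.prod_range_succ]

/-- The words `descend i * ascend j` play the role of multiples of matrix units. Their span is
stable under left multiplication by `A` and `B`, since these act only on the `descend` factor and by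
the three-term recurrence; so it is a left ideal, and it suffices that it contains 1. -/
theorem span_eq_top :
    Submodule.span ℂ (Set.range fun p : Fin d × Fin d => descend B E p.1 * ascend B E p.2) = ⊤ := by
  set W := Submodule.span ℂ
    (Set.range fun p : Fin d × Fin d => descend B E p.1 * ascend B E p.2) with hW
  have mem : ∀ (i : ℕ) (j : Fin d), descend B E i * ascend B E j ∈ W := by
    intro i j
    by_cases hi : i < d
    · exact Submodule.subset_span ⟨(⟨i, hi⟩, j), rfl⟩
    · rw [h.descend_eq_zero (not_lt.1 hi), zero_mul]; exact W.zero_mem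
  -- Each `E i` with `i < d` is `descend i * ascend i` up to a product of the nonzero scalars `s j`.
  have one : (1 : R) ∈ W := by
    rw [← h.sum]
    refine Submodule.sum_mem _ fun i hi => ?_
    rw [Finset.mem_range] at hi
    have h1 : (∏ j ∈ Finset.range i, s j) ≠ 0 := by
      refine Finset.prod_ne_zero_iff.2 fun j hj => h.ne_zero j ?_
      rw [Finset.mem_range] at hj; omega
    have h2 := mem i ⟨i, hi⟩
    rw [h.descend_mul_ascend] at h2
    exact (Submodule.smul_mem_iff _ h1).1 h2
  have hA : ∀ w ∈ W, A * w ∈ W := by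
    intro w hw
    induction hw using Submodule.span_induction with
    | mem w hw =>
      obtain ⟨⟨i, j⟩, rfl⟩ := hw
      dsimp only
      rw [← mul_assoc, h.A_mul_descend, smul_mul_assoc]
      exact W.smul_mem _ (mem _ _)
    | zero => rw [mul_zero]; exact W.zero_mem
    | add x y _ _ hx hy => rw [mul_add]; exact W.add_mem hx hy
    | smul c x _ hx => rw [mul_smul_comm]; exact W.smul_mem _ hx
  have hB : ∀ w ∈ W, B * w ∈ W := by
    intro w hw
    induction hw using Submodule.span_induction with
    | mem w hw =>
      obtain ⟨⟨⟨i, hi⟩, j⟩, rfl⟩ := hw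
      dsimp only
      rw [← mul_assoc]
      cases i with
      | zero =>
        rw [h.B_mul_descend_zero, add_mul, smul_mul_assoc]
        exact W.add_mem (W.smul_mem _ (mem _ _)) (mem _ _)
      | succ i =>
        rw [h.B_mul_descend_succ, add_mul, add_mul, smul_mul_assoc, smul_mul_assoc]
        exact W.add_mem (W.add_mem (W.smul_mem _ (mem _ _)) (W.smul_mem _ (mem _ _))) (mem _ _)
    | zero => rw [mul_zero]; exact W.zero_mem
    | add x y _ _ hx hy => rw [mul_add]; exact W.add_mem hx hy
    | smul c x _ hx => rw [mul_smul_comm]; exact W.smul_mem _ hx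
  have key : ∀ r : R, ∀ w ∈ W, r * w ∈ W := by
    intro r
    have hr : r ∈ Algebra.adjoin ℂ {A, B} := by rw [h.adjoin]; trivial
    induction hr using Algebra.adjoin_induction with
    | mem x hx =>
      rcases hx with rfl | rfl
      · exact hA
      · exact hB
    | algebraMap c => intro w hw; rw [← Algebra.smul_def]; exact W.smul_mem _ hw
    | add x y _ _ hx hy => intro w hw; rw [add_mul]; exact W.add_mem (hx w hw) (hy w hw)
    | mul x y _ _ hx hy => intro w hw; rw [mul_assoc]; exact hx _ (hy _ hw)
  rw [eq_top_iff]
  intro r _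
  simpa using key r 1 one

/-- A surjection from a tridiagonal algebra onto a matrix algebra of the same size is bijective. -/
theorem bijective_of_surjective (f : R →ₐ[ℂ] Matrix (Fin d) (Fin d) ℂ)
    (hf : Function.Surjective f) : Function.Bijective f := by
  have hfin : Module.Finite ℂ R := by
    rw [Module.finite_def, ← h.span_eq_top]
    exact Submodule.fg_span (Set.finite_range _)
  have hle : Module.finrank ℂ R ≤ d * d := by
    rw [← finrank_top, ← h.span_eq_top]
    refine (finrank_range_le_card _).trans ?_
    simp
  have hge := LinearMap.finrank_le_finrank_of_surjective (f := f.toLinearMap) hf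
  have heq : Module.finrank ℂ R = Module.finrank ℂ (Matrix (Fin d) (Fin d) ℂ) := by
    refine le_antisymm ?_ hge
    simpa [Module.finrank_matrix] using hle
  exact ⟨(LinearMap.injective_iff_surjective_of_finrank_eq_finrank heq (f := f.toLinearMap)).2 hf, hf⟩

end IsTridiagonal

end Tridiagonal

/-! ### Corners of `B` forced by the Racah relations. -/

section Corners

variable {R : Type*} [Ring R] [Algebra ℂ R]

/-- Elements `A`, `B` satisfying the Racah relations with equal parameters `α₁ = α₂ = α₃`, where
`t = C + α₁ + α₂ + α₃`, together with spectral projections of `A` for the spins `0, 1, 2, 3`. -/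
structure RacahPair (A B : R) (t : ℂ) (E : ℕ → R) : Prop where
  rel_A : A * (B * A - A * B) - (B * A - A * B) * A =
    (2 * t) • A - (2 : ℂ) • (A * A) - (2 : ℂ) • (A * B + B * A)
  rel_B : B * (A * B - B * A) - (A * B - B * A) * B =
    (2 * t) • B - (2 : ℂ) • (B * B) - (2 : ℂ) • (A * B + B * A)
  idem : ∀ i, E i * E i = E i
  orth : ∀ i j, i ≠ j → E i * E j = 0
  zero : ∀ i, 4 ≤ i → E i = 0
  sum : E 0 + E 1 + E 2 + E 3 = 1
  mul_left : ∀ i : ℕ, A * E i = ((i : ℂ) * (i + 1)) • E i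
  mul_right : ∀ i : ℕ, E i * A = ((i : ℂ) * (i + 1)) • E i

namespace RacahPair

variable {A B : R} {t : ℂ} {E : ℕ → R} (h : RacahPair A B t E)
include h

theorem mul_mul_right (i : ℕ) (x : R) : E i * (A * x) = ((i : ℂ) * (i + 1)) • (E i * x) := by
  rw [← mul_assoc, h.mul_right, smul_mul_assoc]

/-- Compression of `rel_A` multiplies the corner by the scalar in `hc`, up to sign. That scalar
factors as ((i-j)² - 1)((i+j+1)² - 1), so for i ≠ j it vanishes only when |i - j| = 1. -/
theorem corner_ne {i j : ℕ} (hij : i ≠ j)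
    (hc : ((i : ℂ) * (i + 1) - j * (j + 1)) ^ 2 - 2 * (i * (i + 1) + j * (j + 1)) ≠ 0) :
    E i * (B * E j) = 0 := by
  have := congrArg (fun x => E i * (x * E j)) h.rel_A
  simp only [mul_add, add_mul, mul_sub, sub_mul, mul_assoc, h.mul_left, h.mul_mul_right,
    mul_smul_comm, smul_mul_assoc, h.orth i j hij, smul_zero] at this
  refine (smul_eq_zero.1 (?_ : (((i : ℂ) * (i + 1) - j * (j + 1)) ^ 2
    - 2 * (i * (i + 1) + j * (j + 1))) • (E i * (B * E j)) = 0)).resolve_left hc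
  linear_combination (norm := module) (-1 : ℂ) • this

/-- The double commutator vanishes in a diagonal corner, and what remains of `rel_A` determines
4i(i+1) times the corner. At spin 0 it therefore gives no information. -/
theorem corner_self {i : ℕ} (hi : i ≠ 0) :
    E i * (B * E i) = ((t - i * (i + 1)) / 2) • E i := by
  have := congrArg (fun x => E i * (x * E i)) h.rel_A
  simp only [mul_add, add_mul, mul_sub, sub_mul, mul_assoc, h.mul_left, h.mul_mul_right,
    mul_smul_comm, smul_mul_assoc, h.idem] at this
  have h0 : (4 * ((i : ℂ) * (i + 1))) ≠ 0 := by
    have h1 : (i : ℂ) ≠ 0 := by exact_mod_cast hi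
    have h2 : (i : ℂ) + 1 ≠ 0 := by exact_mod_cast i.succ_ne_zero
    exact mul_ne_zero (by norm_num) (mul_ne_zero h1 h2)
  rw [← sub_eq_zero]
  refine (smul_eq_zero.1 (?_ : (4 * ((i : ℂ) * (i + 1))) •
    (E i * (B * E i) - ((t - i * (i + 1)) / 2) • E i) = 0)).resolve_left h0
  linear_combination (norm := module) this

theorem corner_zero_two : E 0 * (B * E 2) = 0 := h.corner_ne (by decide) (by norm_num)
theorem corner_zero_three : E 0 * (B * E 3) = 0 := h.corner_ne (by decide) (by norm_num)
theorem corner_one_three : E 1 * (B * E 3) = 0 := h.corner_ne (by decide) (by norm_num)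
theorem corner_two_zero : E 2 * (B * E 0) = 0 := h.corner_ne (by decide) (by norm_num)
theorem corner_three_zero : E 3 * (B * E 0) = 0 := h.corner_ne (by decide) (by norm_num)
theorem corner_three_one : E 3 * (B * E 1) = 0 := h.corner_ne (by decide) (by norm_num)

theorem eq_sum (x : R) : x = E 0 * x + E 1 * x + E 2 * x + E 3 * x := by
  rw [← add_mul, ← add_mul, ← add_mul, h.sum, one_mul]

theorem col_zero : B * E 0 = E 0 * (B * E 0) + E 1 * (B * E 0) := by
  conv_lhs => rw [h.eq_sum (B * E 0)]
  rw [h.corner_two_zero, h.corner_three_zero, add_zero, add_zero]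

theorem col_one : B * E 1 = E 0 * (B * E 1) + ((t - 2) / 2) • E 1 + E 2 * (B * E 1) := by
  conv_lhs => rw [h.eq_sum (B * E 1)]
  rw [h.corner_three_one, h.corner_self one_ne_zero, add_zero]
  norm_num

theorem col_two : B * E 2 = E 1 * (B * E 2) + ((t - 6) / 2) • E 2 + E 3 * (B * E 2) := by
  conv_lhs => rw [h.eq_sum (B * E 2)]
  rw [h.corner_zero_two, h.corner_self two_ne_zero, zero_add]
  norm_num

theorem col_three : B * E 3 = E 2 * (B * E 3) + ((t - 12) / 2) • E 3 := by
  conv_lhs => rw [h.eq_sum (B * E 3)]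
  rw [h.corner_zero_three, h.corner_one_three, h.corner_self three_ne_zero, zero_add, zero_add]
  norm_num

theorem idem_mul (i : ℕ) (x : R) : E i * (E i * x) = E i * x := by
  rw [← mul_assoc, h.idem]

theorem orth_mul {i j : ℕ} (hij : i ≠ j) (x : R) : E i * (E j * x) = 0 := by
  rw [← mul_assoc, h.orth i j hij, zero_mul]

theorem mul_left_mul (i : ℕ) (x : R) : A * (E i * x) = ((i : ℂ) * (i + 1)) • (E i * x) := by
  rw [← mul_assoc, h.mul_left, smul_mul_assoc]

/-- Once the column of `B` at `E i` is expanded, the inner `A` becomes a scalar on each neighbour.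
The result is a linear relation between the walks from `i` to `i + 1` and back and from `i` to `i -
1` and back. -/
theorem corner_relB (i : ℕ) : (2 : ℂ) • (E i * (B * (A * (B * E i)))) =
    (2 * ((i : ℂ) * (i + 1)) - 2) • (E i * (B * (B * E i)))
      + (2 * t - 4 * ((i : ℂ) * (i + 1))) • (E i * (B * E i)) := by
  have := congrArg (fun x => E i * (x * E i)) h.rel_B
  simp only [mul_add, add_mul, mul_sub, sub_mul, mul_assoc, h.mul_left, h.mul_mul_right,
    mul_smul_comm, smul_mul_assoc] at this
  linear_combination (norm := module) this

theorem relation_zero : (6 : ℂ) • (E 0 * (B * (E 1 * (B * E 0)))) =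
    (2 * t) • (E 0 * (B * E 0)) - (2 : ℂ) • (E 0 * (B * (E 0 * (B * E 0)))) := by
  have := h.corner_relB 0
  rw [h.col_zero] at this
  simp only [mul_add, h.mul_left_mul, mul_smul_comm, h.idem_mul, h.orth_mul zero_ne_one,
    Nat.cast_zero, Nat.cast_one] at this
  linear_combination (norm := module) this

theorem relation_one : (10 : ℂ) • (E 1 * (B * (E 2 * (B * E 1)))) =
    (2 : ℂ) • (E 1 * (B * (E 0 * (B * E 1)))) + ((t - 2) * (t - 6) / 2) • E 1 := by
  have h1 := h.corner_self one_ne_zero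
  have := h.corner_relB 1
  rw [h1, h.col_one] at this
  simp only [mul_add, h.mul_left_mul, h.mul_left, mul_smul_comm, h1,
    Nat.cast_zero, Nat.cast_one, Nat.cast_ofNat] at this
  linear_combination (norm := module) this

theorem relation_two : (14 : ℂ) • (E 2 * (B * (E 3 * (B * E 2)))) =
    (6 : ℂ) • (E 2 * (B * (E 1 * (B * E 2)))) + ((t - 6) * (t - 18) / 2) • E 2 := by
  have h1 := h.corner_self two_ne_zero
  have := h.corner_relB 2
  rw [h1, h.col_two] at this
  simp only [mul_add, h.mul_left_mul, h.mul_left, mul_smul_comm, h1, Nat.cast_one, Nat.cast_ofNat] at this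
  linear_combination (norm := module) this

theorem relation_three : (-10 : ℂ) • (E 3 * (B * (E 2 * (B * E 3)))) =
    ((t - 12) * (t - 36) / 2) • E 3 := by
  have h1 := h.corner_self three_ne_zero
  have := h.corner_relB 3
  rw [h1, h.col_three] at this
  simp only [mul_add, h.mul_left_mul, h.mul_left, mul_smul_comm, h1, Nat.cast_ofNat] at this
  linear_combination (norm := module) this

/-- The square of `E i * B * E j * B * E i` when `E j * B * E i * B * E j` is a scalar. -/
theorem sq_of_smul {i j : ℕ} {p : ℂ} (hp : E j * (B * (E i * (B * E j))) = p • E j) :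
    (E i * (B * (E j * (B * E i)))) * (E i * (B * (E j * (B * E i)))) =
      p • (E i * (B * (E j * (B * E i)))) := by
  have : (E i * (B * (E j * (B * E i)))) * (E i * (B * (E j * (B * E i)))) =
      E i * (B * (E j * (B * (E i * (B * E j))) * (B * E i))) := by
    simp only [mul_assoc, h.idem_mul]
  rw [this, hp]
  simp only [smul_mul_assoc, mul_smul_comm]

/-- The involution `B ↦ t - A - B`. -/
theorem sub_sub : RacahPair A (algebraMap ℂ R t - A - B) t E where
  rel_A := by
    have h1 := h.rel_A
    simp only [Algebra.algebraMap_eq_smul_one, mul_sub, sub_mul, mul_assoc,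
      mul_smul_comm, smul_mul_assoc, one_mul, mul_one] at h1 ⊢
    linear_combination (norm := module) (-1 : ℂ) • h1
  rel_B := by
    have h1 := h.rel_A
    have h2 := h.rel_B
    simp only [Algebra.algebraMap_eq_smul_one, mul_sub, sub_mul, mul_assoc,
      mul_smul_comm, smul_mul_assoc, one_mul, mul_one] at h1 h2 ⊢
    linear_combination (norm := module) h2 - h1
  idem := h.idem
  orth := h.orth
  zero := h.zero
  sum := h.sum
  mul_left := h.mul_left
  mul_right := h.mul_right

end RacahPair

end Corners

/-! ### Closed walks are scalars, one total spin at a time. -/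

section ScalarCorners

variable {R : Type*} [Ring R] [Algebra ℂ R]

/-- The product of the two off-diagonal entries of `B` linking the `A`-eigenspaces of spins `k` and
`k + 1`. -/
def offDiag {K : Type*} [Field K] (t : K) (k : ℕ) : K :=
  (16 - ((k : K) + 1) ^ 2) *
    (((k : K) + 1) ^ 2 * (2 * t - 14) - ((k : K) + 1) ^ 4 - (15 - t) ^ 2) /
    (4 * (4 * ((k : K) + 1) ^ 2 - 1))

/-- The matrix entries of `B` with respect to the spectral projections of `A` are the scalars
predicted by the Racah coefficients. -/
structure IsScalar (B : R) (t : ℂ) (E : ℕ → R) : Prop where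
  diag : E 0 * (B * E 0) = (t / 2) • E 0
  up_zero : E 0 * (B * (E 1 * (B * E 0))) = offDiag t 0 • E 0
  up_one : E 1 * (B * (E 2 * (B * E 1))) = offDiag t 1 • E 1
  up_two : E 2 * (B * (E 3 * (B * E 2))) = offDiag t 2 • E 2
  down_zero : E 1 * (B * (E 0 * (B * E 1))) = offDiag t 0 • E 1
  down_one : E 2 * (B * (E 1 * (B * E 2))) = offDiag t 1 • E 2
  down_two : E 3 * (B * (E 2 * (B * E 3))) = offDiag t 2 • E 3

namespace RacahPair

variable {A B : R} {t : ℂ} {E : ℕ → R} (h : RacahPair A B t E)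
include h

theorem up (hs : IsScalar B t E) : ∀ k, E k * B * E (k + 1) * B * E k = offDiag t k • E k
  | 0 => by simpa only [mul_assoc] using hs.up_zero
  | 1 => by simpa only [mul_assoc] using hs.up_one
  | 2 => by simpa only [mul_assoc] using hs.up_two
  -- `E 3` may be nonzero here; the scalar vanishes through its factor 16 - 4².
  | 3 => by rw [h.zero 4 le_rfl]; norm_num [offDiag]
  | k + 4 => by rw [h.zero (k + 4) (by omega)]; simp

theorem down (hs : IsScalar B t E) :
    ∀ k, E (k + 1) * B * E k * B * E (k + 1) = offDiag t k • E (k + 1)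
  | 0 => by simpa only [mul_assoc] using hs.down_zero
  | 1 => by simpa only [mul_assoc] using hs.down_one
  | 2 => by simpa only [mul_assoc] using hs.down_two
  | k + 3 => by rw [h.zero (k + 3 + 1) (by omega)]; simp

theorem col : ∀ k : ℕ, B * E (k + 1) =
    E k * B * E (k + 1) + ((t - (k + 1 : ℕ) * ((k + 1 : ℕ) + 1)) / 2) • E (k + 1)
      + E (k + 2) * B * E (k + 1)
  | 0 => by rw [h.col_one]; norm_num [mul_assoc]
  | 1 => by rw [h.col_two]; norm_num [mul_assoc]
  | 2 => by rw [h.col_three, h.zero (2 + 2) le_rfl]; norm_num [mul_assoc]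
  | k + 3 => by rw [h.zero (k + 3 + 1) (by omega)]; simp

theorem col_zero' (hs : IsScalar B t E) : B * E 0 =
    ((t - (0 : ℕ) * ((0 : ℕ) + 1)) / 2) • E 0 + E 1 * B * E 0 := by
  rw [h.col_zero, hs.diag]; simp [mul_assoc]

theorem isTridiagonal (hs : IsScalar B t E) (hAB : Algebra.adjoin ℂ {A, B} = ⊤) {k₀ d : ℕ}
    (hlow : ∀ k, k < k₀ → E k = 0) (hhigh : ∀ k, k₀ + d ≤ k → E k = 0) (hd : k₀ + d ≤ 4)
    (hne : ∀ k, k₀ ≤ k → k + 1 < k₀ + d → offDiag t k ≠ 0) :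
    IsTridiagonal A B d (fun i => E (k₀ + i))
      (fun i => ((k₀ + i : ℕ) : ℂ) * ((k₀ + i : ℕ) + 1))
      (fun i => (t - ((k₀ + i : ℕ) : ℂ) * ((k₀ + i : ℕ) + 1)) / 2)
      (fun i => offDiag t (k₀ + i)) where
  adjoin := hAB
  idem i := h.idem _
  zero i hi := hhigh _ (by omega)
  sum := by
    have h4 : ∑ i ∈ Finset.range 4, E i = 1 := by
      simpa [Finset.sum_range_succ] using h.sum
    have h5 : ∑ i ∈ Finset.range (k₀ + d), E i = ∑ i ∈ Finset.range 4, E i :=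
      Finset.sum_subset (Finset.range_mono hd) fun i _ hi =>
        hhigh i (not_lt.1 fun h => hi (Finset.mem_range.2 h))
    rw [h4, Finset.sum_range_add, Finset.sum_eq_zero fun i hi => hlow i (Finset.mem_range.1 hi),
      zero_add] at h5
    exact h5
  mul_left i := h.mul_left _
  zero_col := by
    cases k₀ with
    | zero => exact h.col_zero' hs
    | succ k =>
      have := h.col k
      rw [hlow k k.lt_succ_self] at this
      simpa using this
  succ_col i := h.col (k₀ + i)
  up_down i := h.up hs _
  down_up i := h.down hs _
  ne_zero i hi := hne _ (by omega) (by omega)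

theorem isScalar_of_thirtySix (ht : t = 36) (h0 : E 0 = 0) (h1 : E 1 = 0) (h2 : E 2 = 0) :
    IsScalar B t E := by
  subst ht
  constructor <;> simp only [h0, h1, h2, mul_zero, zero_mul, smul_zero]
  norm_num [offDiag]

/-- The chain has a single link, and at each of its ends the other neighbour is missing, so the
linear relations there determine both closed walks. -/
theorem isScalar_of_twentySeven (ht : t = 27) (h0 : E 0 = 0) (h1 : E 1 = 0) : IsScalar B t E := by
  subst ht
  have e2 := h.relation_two
  have e3 := h.relation_three
  constructor <;> simp only [h0, h1, mul_zero, zero_mul, smul_zero] at e2 e3 ⊢ <;>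
    norm_num [offDiag] at e2 e3 ⊢
  · linear_combination (norm := module) (1 / 14 : ℂ) • e2
  · linear_combination (norm := module) (1 / 10 : ℂ) • e3

theorem isScalar_of_twelve (ht : t = 12) (h0 : E 0 = 0) (h3 : E 3 = 0) : IsScalar B t E := by
  subst ht
  have e2 := h.relation_one
  have e3 := h.relation_two
  constructor <;> simp only [h0, h3, mul_zero, zero_mul, smul_zero] at e2 e3 ⊢ <;>
    norm_num [offDiag] at e2 e3 ⊢
  · linear_combination (norm := module) (1 / 10 : ℂ) • e2
  · linear_combination (norm := module) (-1 / 6 : ℂ) • e3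

/-- The relations at the ends 1 and 3 give scalars. Transported to the middle corner they become
quadratic equations for the walks `2 → 1 → 2` and `2 → 3 → 2`, which are linked by the affine
relation at 2; the quadratic terms cancel and leave a scalar. -/
theorem isScalar_of_twenty (ht : t = 20) (h0 : E 0 = 0) : IsScalar B t E := by
  subst ht
  have e1 := h.relation_one
  have e2 := h.relation_two
  have e3 := h.relation_three
  have p1 : E 1 * (B * (E 2 * (B * E 1))) = (63 / 5 : ℂ) • E 1 := by
    simp only [h0, mul_zero, zero_mul, smul_zero] at e1
    linear_combination (norm := module) (1 / 10 : ℂ) • e1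
  have q3 : E 3 * (B * (E 2 * (B * E 3))) = (32 / 5 : ℂ) • E 3 := by
    linear_combination (norm := module) (-1 / 10 : ℂ) • e3
  have q2 := h.sq_of_smul p1
  have p2 := h.sq_of_smul q3
  have i2 := h.idem_mul 2
  have i2' : E 2 * (B * (E 1 * (B * E 2))) * E 2 = E 2 * (B * (E 1 * (B * E 2))) := by
    simp only [mul_assoc, h.idem]
  have i2'' := h.idem 2
  have hp : E 2 * (B * (E 3 * (B * E 2))) =
    (3 / 7 : ℂ) • (E 2 * (B * (E 1 * (B * E 2)))) + E 2 := by
    linear_combination (norm := module) (1 / 14 : ℂ) • e2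
  rw [hp] at p2
  simp only [add_mul, mul_add, smul_mul_assoc, mul_smul_comm, q2, i2, i2', i2''] at p2
  have hq : E 2 * (B * (E 1 * (B * E 2))) = (63 / 5 : ℂ) • E 2 := by
    linear_combination (norm := module) (7 / 3 : ℂ) • p2
  rw [hq] at hp
  constructor <;> simp only [h0, mul_zero, zero_mul, smul_zero, p1, q3, hp, hq] <;>
    norm_num [offDiag] 
  module

/-- The consequence of the minimal polynomial of `B` in the spin `0` corner. -/
theorem quartic_corner (ht : t = 15)
    (hB : B * (B * (B * B)) - (20 : ℂ) • (B * (B * B)) + (108 : ℂ) • (B * B) - (144 : ℂ) • B = 0)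
    {z : R} (hz : z = E 0 * (B * E 0) - (15 / 2 : ℂ) • E 0) :
    z * (z * (z * z)) + (30 : ℂ) • (z * (z * z)) + (1179 / 4 : ℂ) • (z * z) + (945 : ℂ) • z = 0 := by
  subst ht
  -- Names for the edges of the walk graph 0 - 1 - 2 - 3: `y` is the loop at 0, `u` and `v` join 0
  -- and 1, `w` and `r` join 1 and 2, `g` goes from 2 to 3. The compressed power `E 0 * B ^ n * E 0`
  -- is the sum over closed walks of length n based at 0.
  obtain ⟨y, hy⟩ : ∃ y, y = E 0 * (B * E 0) := ⟨_, rfl⟩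
  obtain ⟨u, hu⟩ : ∃ u, u = E 1 * (B * E 0) := ⟨_, rfl⟩
  obtain ⟨v, hv⟩ : ∃ v, v = E 0 * (B * E 1) := ⟨_, rfl⟩
  obtain ⟨w, hw⟩ : ∃ w, w = E 2 * (B * E 1) := ⟨_, rfl⟩
  obtain ⟨r, hr⟩ : ∃ r, r = E 1 * (B * E 2) := ⟨_, rfl⟩
  obtain ⟨g, hg⟩ : ∃ g, g = E 3 * (B * E 2) := ⟨_, rfl⟩
  obtain ⟨p, hp⟩ : ∃ p, p = v * u := ⟨_, rfl⟩
  have hpy : p = (5 : ℂ) • y - (1 / 3 : ℂ) • (y * y) := by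
    have := h.relation_zero
    have h1 : p = E 0 * (B * (E 1 * (B * E 0))) := by
      rw [hp, hu, hv]; simp only [mul_assoc, h.idem_mul]
    have h2 : y * y = E 0 * (B * (E 0 * (B * E 0))) := by
      rw [hy]; simp only [mul_assoc, h.idem_mul]
    rw [h1, h2, hy]
    linear_combination (norm := module) (1 / 6 : ℂ) • this
  have hrw : r * w = (1 / 5 : ℂ) • (u * v) + (117 / 20 : ℂ) • E 1 := by
    have := h.relation_one
    have h1 : r * w = E 1 * (B * (E 2 * (B * E 1))) := by
      rw [hr, hw]; simp only [mul_assoc, h.idem_mul]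
    have h2 : u * v = E 1 * (B * (E 0 * (B * E 1))) := by
      rw [hu, hv]; simp only [mul_assoc, h.idem_mul]
    rw [h1, h2]
    linear_combination (norm := module) (1 / 10 : ℂ) • this
  have y0 : E 0 * y = y := by rw [hy, h.idem_mul]
  have y0' : y * E 0 = y := by rw [hy]; simp only [mul_assoc, h.idem]
  have u1 : E 1 * u = u := by rw [hu, h.idem_mul]
  have v0 : E 0 * v = v := by rw [hv, h.idem_mul]
  have w2 : E 2 * w = w := by rw [hw, h.idem_mul]
  have u0 : E 0 * u = 0 := by rw [hu, h.orth_mul (by decide)]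
  have w0 : E 0 * w = 0 := by rw [hw, h.orth_mul (by decide)]
  have r0 : E 0 * r = 0 := by rw [hr, h.orth_mul (by decide)]
  have g0 : E 0 * g = 0 := by rw [hg, h.orth_mul (by decide)]
  have B0 : B * E 0 = y + u := by rw [h.col_zero, hy, hu]
  have B1 : B * E 1 = v + (13 / 2 : ℂ) • E 1 + w := by rw [h.col_one, hv, hw]; norm_num
  have B2 : B * E 2 = r + (9 / 2 : ℂ) • E 2 + g := by rw [h.col_two, hr, hg]; norm_num
  have y0x (x : R) : E 0 * (y * x) = y * x := by rw [← mul_assoc, y0]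
  have v0x (x : R) : E 0 * (v * x) = v * x := by rw [← mul_assoc, v0]
  have By (x : R) : B * (y * x) = y * (y * x) + u * (y * x) := by
    rw [← add_mul, ← B0, mul_assoc, y0x]
  have Bu (x : R) : B * (u * x) = v * (u * x) + (13 / 2 : ℂ) • (u * x) + w * (u * x) := by
    rw [← u1, mul_assoc, ← mul_assoc, B1, add_mul, add_mul, smul_mul_assoc]
    simp only [← mul_assoc, u1]
  have Bw (x : R) : B * (w * x) = r * (w * x) + (9 / 2 : ℂ) • (w * x) + g * (w * x) := by
    rw [← w2, mul_assoc, ← mul_assoc, B2, add_mul, add_mul, smul_mul_assoc]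
    simp only [← mul_assoc, w2]
  have Br (x : R) : B * (r * x) = v * (r * x) + (13 / 2 : ℂ) • (r * x) + w * (r * x) := by
    have r1 : E 1 * r = r := by rw [hr, h.idem_mul]
    rw [← r1, mul_assoc, ← mul_assoc, B1, add_mul, add_mul, smul_mul_assoc]
    simp only [← mul_assoc, r1]
  -- A walk of length at most 4 that visits 3 cannot return to 0.
  have Bg (x : R) : E 0 * (B * (g * x)) = 0 := by
    have : E 0 * (B * g) = 0 := by
      rw [hg, ← mul_assoc B, ← mul_assoc (E 0), h.corner_zero_three, zero_mul]
    rw [← mul_assoc B, ← mul_assoc, this, zero_mul]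
  have u0x (x : R) : E 0 * (u * x) = 0 := by rw [← mul_assoc, u0, zero_mul]
  have w0x (x : R) : E 0 * (w * x) = 0 := by rw [← mul_assoc, w0, zero_mul]
  have r0x (x : R) : E 0 * (r * x) = 0 := by rw [← mul_assoc, r0, zero_mul]
  have g0x (x : R) : E 0 * (g * x) = 0 := by rw [← mul_assoc, g0, zero_mul]
  have By1 := By 1
  have Bu1 := Bu 1
  simp only [mul_one] at By1 Bu1
  have px (x : R) : v * (u * x) = p * x := by rw [hp, mul_assoc]
  have p0 : E 0 * p = p := by rw [hp, v0x]
  have p0x (x : R) : E 0 * (p * x) = p * x := by rw [← mul_assoc, p0]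
  have Bp : B * p = y * p + u * p := by rw [← add_mul, ← B0, mul_assoc, p0]
  have Bpx (x : R) : B * (p * x) = y * (p * x) + u * (p * x) := by
    rw [← mul_assoc, Bp, add_mul, mul_assoc, mul_assoc]
  have t2 : E 0 * (B * (B * E 0)) = y * y + p := by
    simp only [B0, By1, Bu1, mul_add, mul_smul_comm, u0, y0x, u0x, w0x, ← hp, p0, smul_zero,
      add_zero]
  -- The only walk reaching 2; the relation at 1 rewrites it in terms of `p`, and `hpy` turns `p`
  -- into a polynomial in `y`.
  have rwu : v * (r * (w * u)) = (1 / 5 : ℂ) • (p * p) + (117 / 20 : ℂ) • p := by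
    rw [← mul_assoc r, hrw, add_mul, smul_mul_assoc, smul_mul_assoc, u1, mul_add, mul_smul_comm,
      mul_smul_comm, mul_assoc, ← hp, px]
  have t3 : E 0 * (B * (B * (B * E 0))) = y * (y * y) + y * p + p * y + (13 / 2 : ℂ) • p := by
    simp only [B0, By, By1, Bu, Bu1, Bp, Bw, mul_add, mul_smul_comm, u0, y0x, u0x, w0x,
      r0x, g0x, px, ← hp, p0, p0x, smul_zero, add_zero]
    module
  have t4 : E 0 * (B * (B * (B * (B * E 0)))) = y * (y * (y * y)) + y * (y * p) + y * (p * y)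
      + (13 / 2 : ℂ) • (y * p) + p * (y * y) + p * p
      + (13 / 2 : ℂ) • (p * y) + (169 / 4 : ℂ) • p
      + (1 / 5 : ℂ) • (p * p) + (117 / 20 : ℂ) • p := by
    simp only [B0, By, By1, Bu, Bu1, Bp, Bpx, Bw, Br, Bg, mul_add, mul_smul_comm, u0, y0x, u0x, w0x,
      r0x, g0x, px, ← hp, p0, p0x, smul_zero, add_zero, rwu]
    module
  have key := congrArg (fun x => E 0 * (x * E 0)) hB
  simp only [sub_mul, add_mul, mul_sub, mul_add, smul_mul_assoc, mul_smul_comm, mul_assoc, t2, t3,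
    t4, ← hy, zero_mul, mul_zero] at key
  rw [← hy] at hz
  obtain rfl : y = z + (15 / 2 : ℂ) • E 0 := by rw [hz]; module
  have z0 : E 0 * z = z := by rw [hz, mul_sub, mul_smul_comm, h.idem, y0]
  have z0x (x : R) : E 0 * (z * x) = z * x := by rw [← mul_assoc, z0]
  have z0' : z * E 0 = z := by rw [hz, sub_mul, smul_mul_assoc, h.idem, y0']
  simp only [hpy, sub_mul, add_mul, mul_sub, mul_add, smul_mul_assoc, mul_smul_comm, mul_assoc, z0,
    z0x, z0', h.idem] at key
  -- The leading coefficient of `key` in `z` is 1 - 1 + 1/9 + 1/45 = 2/15.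
  linear_combination (norm := module) (15 / 2 : ℂ) • key

/-- All four spins survive, and the loop at 0 is free as far as the Racah relations in its diagonal
corner go. The involution exchanging `B` and `D` negates its deviation `z` from 15/2, so `z` and
`-z` satisfy the same quartic, which forces `z = 0`. The remaining walks then follow from both ends
of the chain. -/
theorem isScalar_of_fifteen (ht : t = 15)
    (hB : B * (B * (B * B)) - (20 : ℂ) • (B * (B * B)) + (108 : ℂ) • (B * B) - (144 : ℂ) • B = 0)
    {D : R} (hD : D = algebraMap ℂ R t - A - B)
    (hD' : D * (D * (D * D)) - (20 : ℂ) • (D * (D * D)) + (108 : ℂ) • (D * D) - (144 : ℂ) • D = 0) :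
    IsScalar B t E := by
  have e0 := h.relation_zero
  have e1 := h.relation_one
  have e2 := h.relation_two
  have e3 := h.relation_three
  obtain ⟨z, hz⟩ : ∃ z, z = E 0 * (B * E 0) - (15 / 2 : ℂ) • E 0 := ⟨_, rfl⟩
  have k1 := h.quartic_corner ht hB hz
  have k2 := (hD ▸ h.sub_sub : RacahPair A D t E).quartic_corner ht hD' (z := -z) (by
    rw [hz, hD, ht, Algebra.algebraMap_eq_smul_one]
    simp only [sub_mul, mul_sub, smul_mul_assoc, mul_smul_comm, one_mul, h.mul_left, h.idem]
    norm_num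
    module)
  simp only [neg_mul, mul_neg, neg_neg, smul_neg] at k2
  -- The odd part of the quartic; the even part, after substitution, leaves a nonzero multiple of
  -- z².
  have k3 : z * (z * z) = (-63 / 2 : ℂ) • z := by
    linear_combination (norm := module) (1 / 60 : ℂ) • k1 - (1 / 60 : ℂ) • k2
  have k4 : z * z = 0 := by
    simp only [k3, mul_smul_comm] at k1
    linear_combination (norm := module) (4 / 1053 : ℂ) • k1
  have k5 : z = 0 := by
    rw [k4, mul_zero] at k3
    linear_combination (norm := module) (2 / 63 : ℂ) • k3
  subst ht
  have y : E 0 * (B * E 0) = (15 / 2 : ℂ) • E 0 := by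
    rw [k5] at hz
    linear_combination (norm := module) -hz
  have p0 : E 0 * (B * (E 1 * (B * E 0))) = (75 / 4 : ℂ) • E 0 := by
    simp only [y, mul_smul_comm] at e0
    linear_combination (norm := module) (1 / 6 : ℂ) • e0
  have q3 : E 3 * (B * (E 2 * (B * E 3))) = (63 / 20 : ℂ) • E 3 := by
    linear_combination (norm := module) (-1 / 10 : ℂ) • e3
  have q1 := h.sq_of_smul p0
  have p2 := h.sq_of_smul q3
  have i1 := h.idem 1
  have i2 := h.idem 2
  obtain ⟨w, hw⟩ : ∃ w, w = E 2 * (B * E 1) := ⟨_, rfl⟩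
  obtain ⟨r, hr⟩ : ∃ r, r = E 1 * (B * E 2) := ⟨_, rfl⟩
  have r1 (x : R) : E 1 * (r * x) = r * x := by rw [hr, mul_assoc, h.idem_mul]
  have w2 (x : R) : E 2 * (w * x) = w * x := by rw [hw, mul_assoc, h.idem_mul]
  have r2 : r * E 2 = r := by rw [hr]; simp only [mul_assoc, i2]
  have w1 : w * E 1 = w := by rw [hw]; simp only [mul_assoc, i1]
  have hrw : E 1 * (B * (E 2 * (B * E 1))) = r * w := by
    rw [hr, hw]; simp only [mul_assoc, h.idem_mul]
  have hwr : E 2 * (B * (E 1 * (B * E 2))) = w * r := by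
    rw [hr, hw]; simp only [mul_assoc, h.idem_mul]
  have hq1 : E 1 * (B * (E 0 * (B * E 1))) = (5 : ℂ) • (r * w) - (117 / 4 : ℂ) • E 1 := by
    rw [← hrw]; linear_combination (norm := module) (-1 / 2 : ℂ) • e1
  have hq2 : w * r = (7 / 3 : ℂ) • (E 2 * (B * (E 3 * (B * E 2)))) + (9 / 4 : ℂ) • E 2 := by
    rw [← hwr]; linear_combination (norm := module) (-1 / 6 : ℂ) • e2
  have hp2 : E 2 * (B * (E 3 * (B * E 2))) = (3 / 7 : ℂ) • (w * r) - (27 / 28 : ℂ) • E 2 := by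
    rw [hq2]; module
  rw [hq1] at q1
  rw [hp2] at p2
  simp only [sub_mul, mul_sub, smul_mul_assoc, mul_smul_comm, mul_assoc, i1, i2, w1, r2, r1, w2]
    at q1 p2
  have q1' : r * (w * (r * w)) = (309 / 20 : ℂ) • (r * w) - (1404 / 25 : ℂ) • E 1 := by
    linear_combination (norm := module) (1 / 25 : ℂ) • q1
  have r1' : E 1 * r = r := by rw [hr, h.idem_mul]
  -- The end at 0 gives `r * w` a quadratic with roots 48/5 and 117/20; the end at 3 gives `w * r`
  -- one with roots 48/5 and 9/4. Multiplying the first by `w` and `r` gives a cubic for `w * r`,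
  -- with extra root 0; its only common root with the second quadratic is 48/5.
  have cubic := congrArg (fun x => w * (x * r)) q1'
  simp only [sub_mul, mul_sub, smul_mul_assoc, mul_smul_comm, mul_assoc, r1'] at cubic
  have p2' : w * (r * (w * r)) = (237 / 20 : ℂ) • (w * r) - (108 / 5 : ℂ) • E 2 := by
    linear_combination (norm := module) (49 / 9 : ℂ) • p2
  have q2 : w * r = (48 / 5 : ℂ) • E 2 := by
    simp only [p2', mul_sub, mul_smul_comm, r2] at cubic
    linear_combination (norm := module) (-10 / 81 : ℂ) • cubic
  have p1 : r * w = (48 / 5 : ℂ) • E 1 := by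
    have := congrArg (fun x => r * (x * w)) q2
    have w2' : E 2 * w = w := by rw [hw, h.idem_mul]
    simp only [smul_mul_assoc, mul_smul_comm, mul_assoc, w2'] at this
    linear_combination (norm := module) (20 / 117 : ℂ) • this - (20 / 117 : ℂ) • q1'
  rw [p1] at hq1
  rw [q2] at hp2
  constructor <;> simp only [y, p0, hrw, hwr, p1, q2, q3, hq1, hp2] <;>
    norm_num [offDiag]
  all_goals module

end RacahPair

end ScalarCorners

/-! ### Explicit rational matrices and their verification. -/

section BlockData

/-- Multiplicities of the spins `9/2, 7/2, 5/2, 3/2, 1/2` in the third tensor power. -/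
def mult : Fin 5 → ℕ := ![1, 2, 3, 4, 2]

/-- The smallest intermediate spin in each block. -/
def bottom : Fin 5 → ℕ := ![3, 2, 1, 0, 1]

/-- The value of the central element `G` on each block. -/
def blockG : Fin 5 → ℚ := ![25, 16, 9, 4, 1]

/-- The matrix of `A` in a block. -/
def blockA (l : Fin 5) : Matrix (Fin (mult l)) (Fin (mult l)) ℚ :=
  Matrix.diagonal fun i => ((bottom l + i : ℕ) : ℚ) * ((bottom l + i : ℕ) + 1)

/-- The matrix of `B` in a block. -/
def blockB (l : Fin 5) : Matrix (Fin (mult l)) (Fin (mult l)) ℚ :=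
  Matrix.of fun i j =>
    if i = j then (blockG l + 11 - ((bottom l + i : ℕ) : ℚ) * ((bottom l + i : ℕ) + 1)) / 2
    else if (i : ℕ) = j + 1 then 1
    else if (i : ℕ) + 1 = j then offDiag (blockG l + 11) (bottom l + i)
    else 0

theorem blockA_blockB_rel_A : ∀ l : Fin 5,
    blockA l * (blockB l * blockA l - blockA l * blockB l)
      - (blockB l * blockA l - blockA l * blockB l) * blockA l =
    (2 * (blockG l + 11)) • blockA l - (2 : ℚ) • (blockA l * blockA l)
      - (2 : ℚ) • (blockA l * blockB l + blockB l * blockA l) := by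
  decide +kernel

theorem blockA_blockB_rel_B : ∀ l : Fin 5,
    blockB l * (blockA l * blockB l - blockB l * blockA l)
      - (blockA l * blockB l - blockB l * blockA l) * blockB l =
    (2 * (blockG l + 11)) • blockB l - (2 : ℚ) • (blockB l * blockB l)
      - (2 : ℚ) • (blockA l * blockB l + blockB l * blockA l) := by
  decide +kernel

/-- The Casimir values of the intermediate spins in a block. -/
def blockSpec (l : Fin 5) : List ℚ :=
  (List.range (mult l)).map fun i => ((bottom l + i : ℕ) : ℚ) * ((bottom l + i : ℕ) + 1)

theorem blockSpec_nodup : ∀ l : Fin 5, (blockSpec l).Nodup := by decide +kernel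

theorem blockSpec_subset : ∀ l : Fin 5, (blockSpec l).toFinset ⊆ (J 3 3).image cas := by
  decide +kernel

theorem blockSpec_sub_nodup :
    ∀ l : Fin 5, ((blockSpec l).map fun m => blockG l - 1 / 4 - m).Nodup := by decide +kernel

theorem blockSpec_sub_subset : ∀ l : Fin 5,
    ((blockSpec l).map fun m => blockG l - 1 / 4 - m).toFinset ⊆ M 3 3 3 := by
  decide +kernel

theorem blockA_spec : ∀ l : Fin 5,
    ((blockSpec l).map fun m => blockA l - m • (1 : Matrix _ _ ℚ)).prod = 0 := by
  decide +kernel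

theorem blockB_spec : ∀ l : Fin 5,
    ((blockSpec l).map fun m => blockB l - m • (1 : Matrix _ _ ℚ)).prod = 0 := by
  decide +kernel

/-- The third element is the Casimir of factors 1 and 3, since `K₁₂ + K₂₃ + K₁₃` is `K₁₂₃` plus the
three one-site Casimirs. -/
theorem blockD_spec : ∀ l : Fin 5,
    ((blockSpec l).map fun m =>
      ((blockG l + 11) • (1 : Matrix _ _ ℚ) - blockA l - blockB l) - m • (1 : Matrix _ _ ℚ)).prod
      = 0 := by
  decide +kernel

end BlockData

/-! ### Consequences of the defining relations in a quotient where `C` is a number. -/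

section BarRelations

open Polynomial

theorem Univ.C_central (x : Univ) : Univ.C * x = x * Univ.C := by
  obtain ⟨y, rfl⟩ := RingQuot.mkAlgHom_surjective ℂ UnivRel x
  change Univ.mk Free.C * Univ.mk y = Univ.mk y * Univ.mk Free.C
  have hy : y ∈ Algebra.adjoin ℂ (Set.range (FreeAlgebra.ι ℂ (X := Gen))) := by
    rw [FreeAlgebra.adjoin_range_ι]; trivial
  induction hy using Algebra.adjoin_induction with
  | mem y hy =>
    obtain ⟨g, rfl⟩ := hy
    rw [← map_mul, ← map_mul]
    exact RingQuot.mkAlgHom_rel ℂ (UnivRel.central_C g)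
  | algebraMap c => rw [AlgHom.commutes, Algebra.commutes]
  | add x y _ _ hx hy => rw [map_add, mul_add, add_mul, hx, hy]
  | mul x y _ _ hx hy => rw [map_mul, ← mul_assoc, hx, mul_assoc, hy, mul_assoc]

theorem Univ.adjoin_eq_top :
    Algebra.adjoin ℂ ({Univ.A, Univ.B, Univ.C} ∪ Set.range Univ.α) = ⊤ := by
  rw [eq_top_iff]
  rintro x -
  obtain ⟨y, rfl⟩ := RingQuot.mkAlgHom_surjective ℂ UnivRel x
  change Univ.mk y ∈ _
  have hy : y ∈ Algebra.adjoin ℂ (Set.range (FreeAlgebra.ι ℂ (X := Gen))) := by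
    rw [FreeAlgebra.adjoin_range_ι]; trivial
  induction hy using Algebra.adjoin_induction with
  | mem y hy =>
    obtain ⟨g, rfl⟩ := hy
    apply Algebra.subset_adjoin
    rcases g with _ | _ | _ | i
    · exact Or.inl (Or.inl rfl)
    · exact Or.inl (Or.inr (Or.inl rfl))
    · exact Or.inl (Or.inr (Or.inr rfl))
    · exact Or.inr ⟨i, rfl⟩
  | algebraMap c => rw [AlgHom.commutes]; exact Subalgebra.algebraMap_mem _ _
  | add x y _ _ hx hy => rw [map_add]; exact Subalgebra.add_mem _ hx hy
  | mul x y _ _ hx hy => rw [map_mul]; exact Subalgebra.mul_mem _ hx hy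

theorem Univ.rel_A : Univ.A * (Univ.B * Univ.A - Univ.A * Univ.B)
      - (Univ.B * Univ.A - Univ.A * Univ.B) * Univ.A =
    -2 * Univ.A ^ 2 - 2 * (Univ.A * Univ.B + Univ.B * Univ.A)
      + 2 * (Univ.C + Univ.α 0 + Univ.α 1 + Univ.α 2) * Univ.A
      + 2 * (Univ.α 0 - Univ.α 1) * (Univ.α 2 - Univ.C) := by
  have := RingQuot.mkAlgHom_rel ℂ UnivRel.rel_A
  simp only [Ring.lie_def, map_sub, map_mul, map_add, map_neg, map_pow, map_ofNat] at this
  exact this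

theorem Univ.rel_B : Univ.B * (Univ.A * Univ.B - Univ.B * Univ.A)
      - (Univ.A * Univ.B - Univ.B * Univ.A) * Univ.B =
    -2 * Univ.B ^ 2 - 2 * (Univ.A * Univ.B + Univ.B * Univ.A)
      + 2 * (Univ.C + Univ.α 0 + Univ.α 1 + Univ.α 2) * Univ.B
      + 2 * (Univ.α 0 - Univ.C) * (Univ.α 2 - Univ.α 1) := by
  have := RingQuot.mkAlgHom_rel ℂ UnivRel.rel_B
  simp only [Ring.lie_def, map_sub, map_mul, map_add, map_neg, map_pow, map_ofNat] at this
  exact this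

theorem cas_three : cas 3 = 15 / 4 := by norm_num [cas]

theorem Bar.mk_α (i : Fin 3) :
    Bar.mk 3 3 3 (Univ.α i) = algebraMap ℂ (Bar 3 3 3) (15 / 4) := by
  have := RingQuot.mkAlgHom_rel ℂ (QuotRel.α (n₁ := 3) (n₂ := 3) (n₃ := 3) i)
  rw [AlgHom.commutes] at this
  refine this.trans ?_
  congr 1
  fin_cases i <;> simp [cas_three]

theorem Bar.C_central (x : Bar 3 3 3) : Bar.C * x = x * Bar.C := by
  obtain ⟨y, rfl⟩ := RingQuot.mkAlgHom_surjective ℂ (QuotRel 3 3 3) x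
  change Bar.mk 3 3 3 Univ.C * Bar.mk 3 3 3 y = Bar.mk 3 3 3 y * Bar.mk 3 3 3 Univ.C
  rw [← map_mul, ← map_mul, Univ.C_central]

variable {R : Type*} [Ring R] [Algebra ℂ R] (f : Bar 3 3 3 →ₐ[ℂ] R) {g : ℂ}

/-- All generators other than `A` and `B` become scalars. -/
theorem adjoin_of_surjective (hf : Function.Surjective f)
    (hg : f Bar.C = algebraMap ℂ R (g - 1 / 4)) :
    Algebra.adjoin ℂ {f Bar.A, f Bar.B} = ⊤ := by
  have hs : Function.Surjective (f.comp (Bar.mk 3 3 3)) :=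
    hf.comp (RingQuot.mkAlgHom_surjective ℂ (QuotRel 3 3 3))
  have h1 := Univ.adjoin_eq_top ▸ AlgHom.map_adjoin (f.comp (Bar.mk 3 3 3))
    ({Univ.A, Univ.B, Univ.C} ∪ Set.range Univ.α)
  rw [Algebra.map_top, (AlgHom.range_eq_top _).2 hs] at h1
  rw [eq_top_iff, h1]
  refine Algebra.adjoin_le ?_
  rintro _ ⟨x, hx, rfl⟩
  rcases hx with (rfl | rfl | rfl) | ⟨i, rfl⟩
  · exact Algebra.subset_adjoin (Or.inl rfl)
  · exact Algebra.subset_adjoin (Or.inr rfl)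
  · change f Bar.C ∈ _
    rw [hg]; exact Subalgebra.algebraMap_mem _ _
  · change f (Bar.mk 3 3 3 (Univ.α i)) ∈ _
    rw [Bar.mk_α, AlgHom.commutes]; exact Subalgebra.algebraMap_mem _ _

theorem Bar.map_mk_eq {x y : Univ} (h : QuotRel 3 3 3 x y) :
    f (Bar.mk 3 3 3 x) = f (Bar.mk 3 3 3 y) :=
  congrArg f (RingQuot.mkAlgHom_rel ℂ h)

theorem prodShift_A : prodShift ((J 3 3).image cas) (f Bar.A) = 0 := by
  exact (map_prodShift (f.comp (Bar.mk 3 3 3)) _ _).symm.trans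
    ((Bar.map_mk_eq f QuotRel.A).trans (map_zero (f.comp (Bar.mk 3 3 3))))

theorem prodShift_B : prodShift ((J 3 3).image cas) (f Bar.B) = 0 := by
  exact (map_prodShift (f.comp (Bar.mk 3 3 3)) _ _).symm.trans
    ((Bar.map_mk_eq f QuotRel.B).trans (map_zero (f.comp (Bar.mk 3 3 3))))

theorem prodShift_C : prodShift ((J₃ 3 3 3).image cas) (f Bar.C) = 0 := by
  exact (map_prodShift (f.comp (Bar.mk 3 3 3)) _ _).symm.trans
    ((Bar.map_mk_eq f QuotRel.C).trans (map_zero (f.comp (Bar.mk 3 3 3))))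

theorem prodShift_CA : prodShift (M 3 3 3) (f Bar.C - f Bar.A) = 0 := by
  have := (map_prodShift (f.comp (Bar.mk 3 3 3)) _ _).symm.trans
    ((Bar.map_mk_eq f QuotRel.CA).trans (map_zero (f.comp (Bar.mk 3 3 3))))
  rwa [map_sub] at this

theorem prodShift_CAB (hg : f Bar.C = algebraMap ℂ R (g - 1 / 4)) :
    prodShift ((J 3 3).image cas) (algebraMap ℂ R (g + 11) - f Bar.A - f Bar.B) = 0 := by
  have := (map_prodShift (f.comp (Bar.mk 3 3 3)) _ _).symm.trans
    ((Bar.map_mk_eq f QuotRel.CAB).trans (map_zero (f.comp (Bar.mk 3 3 3))))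
  rw [← this]
  congr 1
  simp only [map_add, map_sub, AlgHom.comp_apply, Bar.mk_α, AlgHom.commutes]
  change _ = f Bar.C - f Bar.A - f Bar.B + _ + _ + _
  rw [hg]
  have : g + 11 = (g - 1 / 4) + 15 / 4 + 15 / 4 + 15 / 4 := by ring
  rw [← map_add, this, map_add, map_add, map_add]
  abel

theorem rel_A_of_eq (hg : f Bar.C = algebraMap ℂ R (g - 1 / 4)) :
    f Bar.A * (f Bar.B * f Bar.A - f Bar.A * f Bar.B)
      - (f Bar.B * f Bar.A - f Bar.A * f Bar.B) * f Bar.A =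
    (2 * (g + 11)) • f Bar.A - (2 : ℂ) • (f Bar.A * f Bar.A)
      - (2 : ℂ) • (f Bar.A * f Bar.B + f Bar.B * f Bar.A) := by
  have := congrArg (f.comp (Bar.mk 3 3 3)) Univ.rel_A
  simp only [map_sub, map_mul, map_add, map_neg, map_pow, map_ofNat, AlgHom.comp_apply,
    Bar.mk_α, AlgHom.commutes] at this
  change f Bar.A * (f Bar.B * f Bar.A - f Bar.A * f Bar.B)
      - (f Bar.B * f Bar.A - f Bar.A * f Bar.B) * f Bar.A = -2 * f Bar.A ^ 2
      - 2 * (f Bar.A * f Bar.B + f Bar.B * f Bar.A) + 2 * (f Bar.C + _ + _ + _) * f Bar.A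
      + 2 * (_ - _) * (_ - f Bar.C) at this
  have h2 : (2 : R) = (2 : ℂ) • (1 : R) := by
    rw [← Algebra.algebraMap_eq_smul_one, map_ofNat]
  rw [this, hg, sub_self, h2]
  simp only [Algebra.algebraMap_eq_smul_one, mul_zero, zero_mul, pow_two, mul_add, add_mul,
    smul_mul_assoc, mul_smul_comm, one_mul, neg_mul, mul_one]
  module

theorem rel_B_of_eq (hg : f Bar.C = algebraMap ℂ R (g - 1 / 4)) :
    f Bar.B * (f Bar.A * f Bar.B - f Bar.B * f Bar.A)
      - (f Bar.A * f Bar.B - f Bar.B * f Bar.A) * f Bar.B =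
    (2 * (g + 11)) • f Bar.B - (2 : ℂ) • (f Bar.B * f Bar.B)
      - (2 : ℂ) • (f Bar.A * f Bar.B + f Bar.B * f Bar.A) := by
  have := congrArg (f.comp (Bar.mk 3 3 3)) Univ.rel_B
  simp only [map_sub, map_mul, map_add, map_neg, map_pow, map_ofNat, AlgHom.comp_apply,
    Bar.mk_α, AlgHom.commutes] at this
  change f Bar.B * (f Bar.A * f Bar.B - f Bar.B * f Bar.A)
      - (f Bar.A * f Bar.B - f Bar.B * f Bar.A) * f Bar.B = -2 * f Bar.B ^ 2
      - 2 * (f Bar.A * f Bar.B + f Bar.B * f Bar.A) + 2 * (f Bar.C + _ + _ + _) * f Bar.B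
      + 2 * (_ - f Bar.C) * (_ - _) at this
  have h2 : (2 : R) = (2 : ℂ) • (1 : R) := by
    rw [← Algebra.algebraMap_eq_smul_one, map_ofNat]
  rw [this, hg, sub_self, h2]
  simp only [Algebra.algebraMap_eq_smul_one, mul_zero, pow_two, mul_add, add_mul,
    smul_mul_assoc, mul_smul_comm, one_mul, neg_mul, mul_one]
  module

/-- The Casimir value of integer spin `k`. -/
noncomputable def intCas (k : ℕ) : ℂ := (k : ℂ) * (k + 1)

theorem intCas_injOn (s : Set ℕ) : Set.InjOn intCas s := by
  intro i _ j _ h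
  have h' : i * (i + 1) = j * (j + 1) := by
    simp only [intCas] at h; exact_mod_cast h
  nlinarith [sq_nonneg ((i : ℤ) - j), h', lt_trichotomy i j]

theorem image_cas_J : (J 3 3).image cas = (Finset.range 4).image fun k : ℕ => (k * (k + 1) : ℚ) := by
  decide +kernel

theorem aeval_of_prodShift_J {x : R} (hx : prodShift ((J 3 3).image cas) x = 0) :
    aeval x (∏ k ∈ Finset.range 4, (X - C (intCas k))) = 0 := by
  rw [image_cas_J, prodShift, Finset.prod_image] at hx
  · simpa [intCas] using hx
  · intro i _ j _ h
    apply intCas_injOn Set.univ trivial trivial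
    have := congrArg (Rat.cast (K := ℂ)) h
    simpa [intCas] using this

theorem quartic_of_prodShift_J {x : R} (hx : prodShift ((J 3 3).image cas) x = 0) :
    x * (x * (x * x)) - (20 : ℂ) • (x * (x * x)) + (108 : ℂ) • (x * x) - (144 : ℂ) • x = 0 := by
  have h := aeval_of_prodShift_J hx
  have : (∏ k ∈ Finset.range 4, (X - C (intCas k))) =
      X * (X * (X * X)) - (20 : ℂ) • (X * (X * X)) + (108 : ℂ) • (X * X) - (144 : ℂ) • (X : ℂ[X]) := by
    simp only [Finset.prod_range_succ, Finset.prod_range_zero, intCas, smul_eq_C_mul]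
    norm_num
    have h2 : (C 2 : ℂ[X]) = 2 := rfl
    have h6 : (C 6 : ℂ[X]) = 6 := rfl
    have h12 : (C 12 : ℂ[X]) = 12 := rfl
    have h20 : (C 20 : ℂ[X]) = 20 := rfl
    have h108 : (C 108 : ℂ[X]) = 108 := rfl
    have h144 : (C 144 : ℂ[X]) = 144 := rfl
    rw [h2, h6, h12, h20, h108, h144]
    ring
  rw [this] at h
  simpa using h

/-- The projection onto the part of intermediate spin `k`. -/
noncomputable def spinProj (x : R) (k : ℕ) : R :=
  if k < 4 then eigenProj (Finset.range 4) intCas x k else 0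

theorem racahPair (hg : f Bar.C = algebraMap ℂ R (g - 1 / 4)) :
    RacahPair (f Bar.A) (f Bar.B) (g + 11) (spinProj (f Bar.A)) := by
  have hx := aeval_of_prodShift_J (prodShift_A f)
  have hv := intCas_injOn (Finset.range 4)
  refine ⟨rel_A_of_eq f hg, rel_B_of_eq f hg, ?_, ?_, ?_, ?_, ?_, ?_⟩
  · intro i
    unfold spinProj
    split_ifs with hi
    · rw [eigenProj_mul_eigenProj hv hx (Finset.mem_range.2 hi) (Finset.mem_range.2 hi), if_pos rfl]
    · simp
  · intro i j hij
    unfold spinProj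
    split_ifs with hi hj
    · rw [eigenProj_mul_eigenProj hv hx (Finset.mem_range.2 hi) (Finset.mem_range.2 hj), if_neg hij]
    all_goals simp
  · intro i hi
    rw [spinProj, if_neg (by omega)]
  · have := sum_eigenProj (x := f Bar.A) hv ⟨0, by simp⟩
    simpa [Finset.sum_range_succ, spinProj] using this
  · intro i
    unfold spinProj
    split_ifs with hi
    · exact mul_eigenProj hv hx i
    · simp
  · intro i
    unfold spinProj
    split_ifs with hi
    · exact eigenProj_mul_right hv hx i
    · simp

end BarRelations

/-! ### A generation criterion for the full matrix algebra. -/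

section FullMatrixAlgebra

open Polynomial

theorem aeval_diagonal {n : Type*} [Fintype n] [DecidableEq n] (v : n → ℂ) (p : ℂ[X]) :
    aeval (Matrix.diagonal v) p = Matrix.diagonal fun i => p.eval (v i) := by
  have h := aeval_algHom_apply (Matrix.diagonalAlgHom (n := n) (α := ℂ) ℂ) v p
  rw [Matrix.diagonalAlgHom_apply, Matrix.diagonalAlgHom_apply] at h
  rw [h]
  congr 1
  funext i
  have := aeval_algHom_apply (Pi.evalAlgHom ℂ (fun _ : n => ℂ) i) v p
  simp

/-- Interpolation in the diagonal matrix yields the diagonal matrix units; compressing `B` between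
them yields the units next to the diagonal, whose products are all the others. -/
theorem subalgebra_eq_top {d : ℕ} {S : Subalgebra ℂ (Matrix (Fin d) (Fin d) ℂ)} {v : Fin d → ℂ}
    (hv : Function.Injective v) (hA : Matrix.diagonal v ∈ S) {B : Matrix (Fin d) (Fin d) ℂ}
    (hB : B ∈ S) (hlow : ∀ i j : Fin d, (i : ℕ) = j + 1 → B i j ≠ 0)
    (hup : ∀ i j : Fin d, (i : ℕ) + 1 = j → B i j ≠ 0) : S = ⊤ := by
  have diag : ∀ i, Matrix.single i i (1 : ℂ) ∈ S := by
    intro i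
    have h1 : aeval (Matrix.diagonal v) (Lagrange.basis Finset.univ v i) ∈ S :=
      Algebra.adjoin_le (Set.singleton_subset_iff.2 hA) (aeval_mem_adjoin_singleton ℂ _)
    convert h1
    rw [aeval_diagonal, ← Matrix.diagonal_single]
    congr 1
    funext j
    rcases eq_or_ne i j with rfl | hij
    · rw [Lagrange.eval_basis_self hv.injOn (Finset.mem_univ i), Pi.single_eq_same]
    · rw [Lagrange.eval_basis_of_ne hij (Finset.mem_univ j), Pi.single_eq_of_ne hij.symm]
  have link : ∀ i j, B i j ≠ 0 → Matrix.single i j (1 : ℂ) ∈ S := by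
    intro i j hij
    have h1 := S.smul_mem (S.mul_mem (S.mul_mem (diag i) hB) (diag j)) (B i j)⁻¹
    rwa [Matrix.single_mul_mul_single, Matrix.smul_single, one_mul, mul_one, smul_eq_mul,
      inv_mul_cancel₀ hij] at h1
  have down : ∀ (n : ℕ) (i j : Fin d), (i : ℕ) = j + n → Matrix.single i j (1 : ℂ) ∈ S := by
    intro n
    induction n with
    | zero => intro i j h; rw [Fin.ext h]; exact diag _
    | succ n ih =>
      intro i j h
      have hk : (j : ℕ) + n < d := by omega
      have h1 := S.mul_mem (link i ⟨j + n, hk⟩ (hlow _ _ (by simp only; omega)))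
        (ih ⟨j + n, hk⟩ j rfl)
      rwa [Matrix.single_mul_single_same, one_mul] at h1
  have up : ∀ (n : ℕ) (i j : Fin d), (i : ℕ) + n = j → Matrix.single i j (1 : ℂ) ∈ S := by
    intro n
    induction n with
    | zero => intro i j h; rw [Fin.ext h]; exact diag _
    | succ n ih =>
      intro i j h
      have hk : (i : ℕ) + n < d := by omega
      have h1 := S.mul_mem (ih i ⟨i + n, hk⟩ rfl)
        (link ⟨i + n, hk⟩ j (hup _ _ (by simp only; omega)))
      rwa [Matrix.single_mul_single_same, one_mul] at h1
  rw [eq_top_iff]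
  rintro X -
  rw [Matrix.matrix_eq_sum_single X]
  refine S.sum_mem fun i _ => S.sum_mem fun j _ => ?_
  have : Matrix.single i j (X i j) = X i j • Matrix.single i j (1 : ℂ) := by
    rw [Matrix.smul_single, smul_eq_mul, mul_one]
  rw [this]
  refine S.smul_mem ?_ _
  rcases le_total (i : ℕ) j with h | h
  · exact up (j - i) i j (by omega)
  · exact down (i - j) i j (by omega)

end FullMatrixAlgebra

/-! ### The blocks are tridiagonal. -/

section Blocks

open Polynomial

/-- The ring structure of a block, compatible with its semiring structure by definition. -/
noncomputable abbrev Block.ring (n₁ n₂ n₃ : ℕ) (g : ℂ) : Ring (Block n₁ n₂ n₃ g) :=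
  Algebra.semiringToRing ℂ

/-- The ring structure of the quotiented Racah algebra, compatible with its semiring structure by
definition. -/
noncomputable abbrev Bar.ring (n₁ n₂ n₃ : ℕ) : Ring (Bar n₁ n₂ n₃) :=
  Algebra.semiringToRing ℂ

attribute [local instance] Block.ring

theorem Block.mk_C (g : ℂ) :
    Block.mk 3 3 3 g Bar.C = algebraMap ℂ (Block 3 3 3 g) (g - 1 / 4) := by
  have := RingQuot.mkAlgHom_rel ℂ (BlockRel.G (n₁ := 3) (n₂ := 3) (n₃ := 3) (g := g))
  rw [AlgHom.commutes, Bar.G, map_add, AlgHom.commutes] at this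
  rw [map_sub, ← this]
  exact (add_sub_cancel_right _ _).symm

theorem Block.mk_surjective (g : ℂ) : Function.Surjective (Block.mk 3 3 3 g) :=
  RingQuot.mkAlgHom_surjective ℂ (BlockRel 3 3 3 g)

/-- `M` mixes the edges of all blocks, so it has to be checked that no edge of another block
accidentally has the same difference as an inadmissible pair. -/
theorem not_mem_M : ∀ l : Fin 5, ∀ k < 4, (k < bottom l ∨ bottom l + mult l ≤ k) →
    blockG l - 1 / 4 - (k : ℚ) * (k + 1) ∉ M 3 3 3 := by
  decide +kernel

theorem bottom_add_mult_le : ∀ l : Fin 5, bottom l + mult l ≤ 4 := by decide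

/-- With n = k + 1 and γ the square root of G, the numerator is (16 - n²)((γ+2)² - n²)(n² - (γ-2)²).
Its zeros 4, γ + 2 and |γ - 2| lie outside the links of the chain. -/
theorem offDiag_ne_zero : ∀ l : Fin 5, ∀ k < 4, bottom l ≤ k → k + 1 < bottom l + mult l →
    offDiag (blockG l + 11) k ≠ 0 := by
  decide +kernel

theorem cast_offDiag (t : ℚ) (k : ℕ) : ((offDiag t k : ℚ) : ℂ) = offDiag (t : ℂ) k := by
  simp [offDiag]

variable {R : Type*} [Ring R] [Algebra ℂ R] {f : Bar 3 3 3 →ₐ[ℂ] R} {l : Fin 5}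

theorem spinProj_eq_zero (hf : f Bar.C = algebraMap ℂ R ((blockG l : ℂ) - 1 / 4)) {k : ℕ}
    (hk : k < bottom l ∨ bottom l + mult l ≤ k) : spinProj (f Bar.A) k = 0 := by
  by_cases h4 : k < 4
  · refine eq_zero_of_prodShift_eq_zero (prodShift_CA f) (not_mem_M l k h4 hk) ?_
    rw [sub_mul, (racahPair f hf).mul_left, hf, ← Algebra.smul_def, ← sub_smul]
    push_cast
    rfl
  · rw [spinProj, if_neg h4]

theorem isScalar (hf : f Bar.C = algebraMap ℂ R ((blockG l : ℂ) - 1 / 4)) :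
    IsScalar (f Bar.B) ((blockG l : ℂ) + 11) (spinProj (f Bar.A)) := by
  have h := racahPair f hf
  have h0 (k : ℕ) := spinProj_eq_zero hf (k := k)
  fin_cases l
  · exact h.isScalar_of_thirtySix (by norm_num [blockG]) (h0 0 (by decide)) (h0 1 (by decide))
      (h0 2 (by decide))
  · exact h.isScalar_of_twentySeven (by norm_num [blockG]) (h0 0 (by decide)) (h0 1 (by decide))
  · exact h.isScalar_of_twenty (by norm_num [blockG]) (h0 0 (by decide))
  · exact h.isScalar_of_fifteen (by norm_num [blockG])
      (quartic_of_prodShift_J (prodShift_B f)) rfl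
      (quartic_of_prodShift_J (prodShift_CAB f hf))
  · exact h.isScalar_of_twelve (by norm_num [blockG]) (h0 0 (by decide)) (h0 3 (by decide))

theorem exists_isTridiagonal (hf : f Bar.C = algebraMap ℂ R ((blockG l : ℂ) - 1 / 4))
    (hs : Function.Surjective f) :
    ∃ E a b s, IsTridiagonal (f Bar.A) (f Bar.B) (mult l) E a b s :=
  ⟨_, _, _, _, (racahPair f hf).isTridiagonal (isScalar hf) (adjoin_of_surjective f hs hf)
    (fun _ hk => spinProj_eq_zero hf (Or.inl hk)) (fun _ hk => spinProj_eq_zero hf (Or.inr hk))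
    (bottom_add_mult_le l) fun k h1 h2 => by
      have h3 := offDiag_ne_zero l k (by have := bottom_add_mult_le l; omega) h1 h2
      have h4 : ((offDiag (blockG l + 11) k : ℚ) : ℂ) ≠ 0 := Rat.cast_ne_zero.2 h3
      rw [cast_offDiag] at h4
      exact_mod_cast h4⟩

end Blocks

/-! ### The explicit matrices represent the quotiented algebra. -/

section BlockRepresentation

open Polynomial

/-- Entrywise inclusion of rational into complex matrices. -/
noncomputable def toComplex (n : Type*) [Fintype n] [DecidableEq n] :
    Matrix n n ℚ →ₐ[ℚ] Matrix n n ℂ :=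
  (Algebra.ofId ℚ ℂ).mapMatrix

variable {n : Type*} [Fintype n] [DecidableEq n]

theorem toComplex_apply (X : Matrix n n ℚ) (i j : n) : toComplex n X i j = (X i j : ℂ) := rfl

theorem toComplex_smul (q : ℚ) (X : Matrix n n ℚ) :
    toComplex n (q • X) = (q : ℂ) • toComplex n X := by
  ext i j
  simp [toComplex_apply]

theorem prodShift_list {R : Type*} [Ring R] [Algebra ℂ R] {S : Finset ℚ} {L : List ℚ}
    (hL : L.Nodup) (hS : L.toFinset ⊆ S) {x : R}
    (h : (L.map fun m : ℚ => x - algebraMap ℂ R (m : ℂ)).prod = 0) : prodShift S x = 0 := by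
  refine prodShift_eq_zero_of_subset hS ?_
  rw [prodShift, List.prod_toFinset _ hL, map_list_prod, List.map_map, ← h]
  congr 1
  refine List.map_congr_left fun m _ => ?_
  simp

theorem toComplex_list_prod {L : List ℚ} {X : Matrix n n ℚ}
    (h : (L.map fun m => X - m • (1 : Matrix n n ℚ)).prod = 0) :
    (L.map fun m : ℚ => toComplex n X - algebraMap ℂ (Matrix n n ℂ) (m : ℂ)).prod = 0 := by
  have := congrArg (toComplex n) h
  rw [map_list_prod, List.map_map, map_zero] at this
  rw [← this]
  congr 1
  refine List.map_congr_left fun m _ => ?_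
  simp only [Function.comp_apply, map_sub, toComplex_smul, map_one, Algebra.algebraMap_eq_smul_one]

theorem prodShift_sub_list {R : Type*} [Ring R] [Algebra ℂ R] {S : Finset ℚ} {L : List ℚ} {c : ℚ}
    (hL : (L.map fun m => c - m).Nodup) (hS : (L.map fun m => c - m).toFinset ⊆ S) {x : R}
    (h : (L.map fun m : ℚ => x - algebraMap ℂ R (m : ℂ)).prod = 0) :
    prodShift S (algebraMap ℂ R (c : ℂ) - x) = 0 := by
  refine prodShift_list hL hS ?_
  rw [List.map_map]
  have : ((fun m : ℚ => algebraMap ℂ R (c : ℂ) - x - algebraMap ℂ R (m : ℂ)) ∘ fun m => c - m) =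
      fun m : ℚ => - (x - algebraMap ℂ R (m : ℂ)) := by
    funext m
    simp only [Function.comp_apply, Rat.cast_sub, map_sub]
    abel
  rw [this]
  have h2 : ∀ L : List ℚ, (L.map fun m : ℚ => - (x - algebraMap ℂ R (m : ℂ))).prod =
      (-1) ^ L.length * (L.map fun m : ℚ => x - algebraMap ℂ R (m : ℂ)).prod := by
    intro L
    induction L with
    | nil => simp
    | cons a L ih =>
      rw [List.map_cons, List.prod_cons, ih, List.map_cons, List.prod_cons, List.length_cons,
        pow_succ, neg_mul, mul_neg_one, neg_mul, ← mul_assoc, ← mul_assoc,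
        ((Commute.neg_one_left (x - algebraMap ℂ R (a : ℂ))).pow_left L.length).eq]
  rw [h2, h, mul_zero]

end BlockRepresentation

section BlockRepresentation

attribute [local instance] Block.ring

open Polynomial

/-- The representation of the free algebra on a block. -/
noncomputable def freeRep (l : Fin 5) : Free →ₐ[ℂ] Matrix (Fin (mult l)) (Fin (mult l)) ℂ :=
  FreeAlgebra.lift ℂ fun
    | Gen.A => toComplex _ (blockA l)
    | Gen.B => toComplex _ (blockB l)
    | Gen.C => algebraMap ℂ _ ((blockG l - 1 / 4 : ℚ) : ℂ)
    | Gen.α _ => algebraMap ℂ _ (15 / 4)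

theorem freeRep_A (l : Fin 5) : freeRep l Free.A = toComplex _ (blockA l) :=
  FreeAlgebra.lift_ι_apply _ _

theorem freeRep_B (l : Fin 5) : freeRep l Free.B = toComplex _ (blockB l) :=
  FreeAlgebra.lift_ι_apply _ _

theorem freeRep_C (l : Fin 5) : freeRep l Free.C = algebraMap ℂ _ ((blockG l - 1 / 4 : ℚ) : ℂ) :=
  FreeAlgebra.lift_ι_apply _ _

theorem freeRep_α (l : Fin 5) (i : Fin 3) :
    freeRep l (FreeAlgebra.ι ℂ (Gen.α i)) = algebraMap ℂ _ (15 / 4) :=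
  FreeAlgebra.lift_ι_apply _ _

theorem freeRep_rel (l : Fin 5) ⦃x y : Free⦄ (h : UnivRel x y) : freeRep l x = freeRep l y := by
  have h2 : (2 : Matrix (Fin (mult l)) (Fin (mult l)) ℂ) = (2 : ℂ) • 1 := by
    rw [← Algebra.algebraMap_eq_smul_one, map_ofNat]
  cases h with
  | central_C g => rw [map_mul, map_mul, freeRep_C, Algebra.commutes]
  | central_α i g => rw [map_mul, map_mul, freeRep_α, Algebra.commutes]
  | rel_B =>
    have h1 := congrArg (toComplex _) (blockA_blockB_rel_B l)
    simp only [map_sub, map_mul, map_add, toComplex_smul] at h1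
    simp only [Ring.lie_def, map_sub, map_mul, map_add, map_neg, map_pow, map_ofNat, freeRep_A,
      freeRep_B, freeRep_C, freeRep_α, h1]
    rw [sub_self, h2]
    simp only [Algebra.algebraMap_eq_smul_one, mul_zero, pow_two, mul_add, add_mul,
      smul_mul_assoc, mul_smul_comm, one_mul, neg_mul]
    push_cast
    module
  | rel_A =>
    have h1 := congrArg (toComplex _) (blockA_blockB_rel_A l)
    simp only [map_sub, map_mul, map_add, toComplex_smul] at h1
    simp only [Ring.lie_def, map_sub, map_mul, map_add, map_neg, map_pow, map_ofNat, freeRep_A,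
      freeRep_B, freeRep_C, freeRep_α, h1]
    rw [sub_self, h2]
    simp only [Algebra.algebraMap_eq_smul_one, mul_zero, zero_mul, pow_two, mul_add, add_mul,
      smul_mul_assoc, mul_smul_comm, one_mul, neg_mul]
    push_cast
    module

/-- The representation of the universal Racah algebra on a block. -/
noncomputable def univRep (l : Fin 5) : Univ →ₐ[ℂ] Matrix (Fin (mult l)) (Fin (mult l)) ℂ :=
  RingQuot.liftAlgHom ℂ ⟨freeRep l, freeRep_rel l⟩

theorem univRep_mk (l : Fin 5) (x : Free) : univRep l (Univ.mk x) = freeRep l x :=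
  RingQuot.liftAlgHom_mkAlgHom_apply ℂ _ _ _

theorem univRep_A (l : Fin 5) : univRep l Univ.A = toComplex _ (blockA l) :=
  (univRep_mk l _).trans (freeRep_A l)

theorem univRep_B (l : Fin 5) : univRep l Univ.B = toComplex _ (blockB l) :=
  (univRep_mk l _).trans (freeRep_B l)

theorem univRep_C (l : Fin 5) : univRep l Univ.C = algebraMap ℂ _ ((blockG l - 1 / 4 : ℚ) : ℂ) :=
  (univRep_mk l _).trans (freeRep_C l)

theorem univRep_α (l : Fin 5) (i : Fin 3) : univRep l (Univ.α i) = algebraMap ℂ _ (15 / 4) :=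
  (univRep_mk l _).trans (freeRep_α l i)

theorem blockG_mem : ∀ l : Fin 5, [blockG l - 1 / 4].toFinset ⊆ (J₃ 3 3 3).image cas := by
  decide +kernel

theorem univRep_rel (l : Fin 5) ⦃x y : Univ⦄ (h : QuotRel 3 3 3 x y) :
    univRep l x = univRep l y := by
  have hA := toComplex_list_prod (blockA_spec l)
  have hB := toComplex_list_prod (blockB_spec l)
  have hD := toComplex_list_prod (blockD_spec l)
  have hD' : toComplex _ ((blockG l + 11) • (1 : Matrix _ _ ℚ) - blockA l - blockB l) =
      algebraMap ℂ _ ((blockG l + 11 : ℚ) : ℂ) - toComplex _ (blockA l)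
        - toComplex _ (blockB l) := by
    rw [map_sub, map_sub, toComplex_smul, map_one, Algebra.algebraMap_eq_smul_one]
  rw [hD'] at hD
  have nd := blockSpec_nodup l
  have sub := blockSpec_subset l
  have nd' := blockSpec_sub_nodup l
  have sub' := blockSpec_sub_subset l
  cases h with
  | α i =>
    rw [univRep_α, AlgHom.commutes]
    congr 1
    fin_cases i <;> simp [cas_three]
  | A => rw [map_prodShift, map_zero, univRep_A, prodShift_list nd sub hA]
  | B => rw [map_prodShift, map_zero, univRep_B, prodShift_list nd sub hB]
  | C =>
    rw [map_prodShift, map_zero, univRep_C]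
    exact prodShift_list (List.nodup_singleton _) (blockG_mem l) (by simp)
  | CAB =>
    rw [map_prodShift, map_zero, ← prodShift_list nd sub hD]
    congr 1
    simp only [map_add, map_sub, univRep_A, univRep_B, univRep_C, univRep_α]
    have : ((blockG l + 11 : ℚ) : ℂ) = ((blockG l - 1 / 4 : ℚ) : ℂ) + 15 / 4 + 15 / 4 + 15 / 4 := by
      push_cast; ring
    rw [this, map_add, map_add, map_add]
    abel
  -- Here `A + B - α₁ - α₂ - α₃` is `C - D` with `D` the third intermediate Casimir, so this case
  -- has the same form as `CA` and `CB`.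
  | AB =>
    rw [map_prodShift, map_zero, ← prodShift_sub_list nd' sub' hD]
    congr 1
    simp only [map_add, map_sub, univRep_A, univRep_B, univRep_α]
    have : ((blockG l + 11 : ℚ) : ℂ) = ((blockG l - 1 / 4 : ℚ) : ℂ) + 15 / 4 + 15 / 4 + 15 / 4 := by
      push_cast; ring
    rw [this, map_add, map_add, map_add]
    abel
  | CA =>
    rw [map_prodShift, map_zero, map_sub, univRep_A, univRep_C, prodShift_sub_list nd' sub' hA]
  | CB =>
    rw [map_prodShift, map_zero, map_sub, univRep_B, univRep_C, prodShift_sub_list nd' sub' hB]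

/-- The representation of the quotiented Racah algebra on a block. -/
noncomputable def barRep (l : Fin 5) : Bar 3 3 3 →ₐ[ℂ] Matrix (Fin (mult l)) (Fin (mult l)) ℂ :=
  RingQuot.liftAlgHom ℂ ⟨univRep l, univRep_rel l⟩

theorem barRep_mk (l : Fin 5) (x : Univ) : barRep l (Bar.mk 3 3 3 x) = univRep l x :=
  RingQuot.liftAlgHom_mkAlgHom_apply ℂ _ _ _

theorem barRep_A (l : Fin 5) : barRep l Bar.A = toComplex _ (blockA l) :=
  (barRep_mk l _).trans (univRep_A l)

theorem barRep_B (l : Fin 5) : barRep l Bar.B = toComplex _ (blockB l) :=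
  (barRep_mk l _).trans (univRep_B l)

theorem barRep_C (l : Fin 5) : barRep l Bar.C = algebraMap ℂ _ ((blockG l : ℂ) - 1 / 4) := by
  refine (barRep_mk l _).trans ((univRep_C l).trans ?_)
  push_cast
  rfl

theorem barRep_rel (l : Fin 5) ⦃x y : Bar 3 3 3⦄ (h : BlockRel 3 3 3 (blockG l) x y) :
    barRep l x = barRep l y := by
  cases h
  rw [Bar.G, map_add, barRep_C, AlgHom.commutes, AlgHom.commutes, ← map_add, sub_add_cancel]

/-- The representation of a block. -/
noncomputable def blockRep (l : Fin 5) :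
    Block 3 3 3 (blockG l) →ₐ[ℂ] Matrix (Fin (mult l)) (Fin (mult l)) ℂ :=
  RingQuot.liftAlgHom ℂ ⟨barRep l, barRep_rel l⟩

theorem blockRep_mk (l : Fin 5) (x : Bar 3 3 3) :
    blockRep l (Block.mk 3 3 3 (blockG l) x) = barRep l x :=
  RingQuot.liftAlgHom_mkAlgHom_apply ℂ _ _ _

theorem blockB_lower_ne_zero (l : Fin 5) (i j : Fin (mult l)) (h : (i : ℕ) = j + 1) :
    blockB l i j ≠ 0 := by
  have h1 : i ≠ j := by rintro rfl; omega
  rw [blockB, Matrix.of_apply, if_neg h1, if_pos h]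
  exact one_ne_zero

theorem blockB_upper_ne_zero (l : Fin 5) (i j : Fin (mult l)) (h : (i : ℕ) + 1 = j) :
    blockB l i j ≠ 0 := by
  have h1 : i ≠ j := by rintro rfl; omega
  have h2 : ¬ (i : ℕ) = j + 1 := by omega
  rw [blockB, Matrix.of_apply, if_neg h1, if_neg h2, if_pos h]
  have := bottom_add_mult_le l
  exact offDiag_ne_zero l _ (by omega) (by omega) (by omega)

theorem barRep_surjective (l : Fin 5) : Function.Surjective (barRep l) := by
  rw [← AlgHom.range_eq_top]
  refine subalgebra_eq_top (v := fun i => intCas (bottom l + i)) ?_ ⟨Bar.A, ?_⟩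
    (B := toComplex _ (blockB l)) ⟨Bar.B, barRep_B l⟩ ?_ ?_
  · intro i j h
    have := intCas_injOn Set.univ trivial trivial h
    exact Fin.ext (by omega)
  · refine (barRep_A l).trans ?_
    ext i j
    rw [toComplex_apply, blockA, Matrix.diagonal_apply, Matrix.diagonal_apply]
    split_ifs <;> simp [intCas]
  · intro i j h
    rw [toComplex_apply, Rat.cast_ne_zero]
    exact blockB_lower_ne_zero l i j h
  · intro i j h
    rw [toComplex_apply, Rat.cast_ne_zero]
    exact blockB_upper_ne_zero l i j h

/-- The words bound the dimension from above; the explicit representation, being surjective, bounds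
it from below. -/
theorem blockRep_bijective (l : Fin 5) : Function.Bijective (blockRep l) := by
  obtain ⟨E, a, b, s, h⟩ := exists_isTridiagonal (Block.mk_C (blockG l)) (Block.mk_surjective _)
  refine h.bijective_of_surjective (blockRep l) fun X => ?_
  obtain ⟨x, rfl⟩ := barRep_surjective l X
  exact ⟨_, blockRep_mk l x⟩

theorem finrank_block (l : Fin 5) :
    Module.finrank ℂ (Block 3 3 3 (blockG l)) = mult l * mult l := by
  rw [(LinearEquiv.ofBijective (blockRep l).toLinearMap (blockRep_bijective l)).finrank_eq]
  simp [Module.finrank_matrix]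

end BlockRepresentation

/-! ### Splitting along the central element. -/

section Decomposition

attribute [local instance] Block.ring Bar.ring

open Polynomial

/-- Value of `C` on a block. -/
noncomputable def blockC (l : Fin 5) : ℂ := (blockG l : ℂ) - 1 / 4

theorem blockC_injective : Function.Injective blockC := by
  intro i j h
  have h1 : blockG i = blockG j := by simpa [blockC] using h
  have : ∀ i j, blockG i = blockG j → i = j := by decide +kernel
  exact this i j h1

theorem image_cas_J₃ :
    (J₃ 3 3 3).image cas = Finset.univ.image fun l : Fin 5 => blockG l - 1 / 4 := by
  decide +kernel

theorem aeval_C : aeval (Bar.C : Bar 3 3 3) (∏ l ∈ Finset.univ, (X - C (blockC l))) = 0 := by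
  have hx := prodShift_C (AlgHom.id ℂ (Bar 3 3 3))
  rw [image_cas_J₃, prodShift, Finset.prod_image] at hx
  · simpa [blockC] using hx
  · intro i _ j _ h
    exact blockC_injective (by simpa [blockC] using congrArg (Rat.cast (K := ℂ)) h)

/-- The central idempotents of the quotiented Racah algebra. -/
noncomputable def blockProj (l : Fin 5) : Bar 3 3 3 := eigenProj Finset.univ blockC Bar.C l

theorem blockProj_comm (l : Fin 5) (x : Bar 3 3 3) : blockProj l * x = x * blockProj l :=
  (eigenProj_comm (show Commute Bar.C x from Bar.C_central x) l).eq

theorem sum_blockProj : ∑ l, blockProj l = 1 :=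
  sum_eigenProj blockC_injective.injOn Finset.univ_nonempty

theorem mk_blockProj (l m : Fin 5) :
    Block.mk 3 3 3 (blockG m) (blockProj l) = if l = m then 1 else 0 := by
  have := map_eigenProj (s := Finset.univ) (v := blockC) (x := Bar.C)
    (Block.mk 3 3 3 (blockG m)) l
  rw [Block.mk_C] at this
  exact this.trans (eigenProj_algebraMap (v := blockC) blockC_injective.injOn (Finset.mem_univ _)
    (Finset.mem_univ m))

/-- The central idempotent satisfies `blockProj l * (G - g) = 0`, so multiplication by it respects
the whole congruence generated by `G = g`. This gives injectivity of the map to the product of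
blocks. -/
theorem blockProj_mul_eq_of_mk_eq {l : Fin 5} {x y : Bar 3 3 3}
    (h : Block.mk 3 3 3 (blockG l) x = Block.mk 3 3 3 (blockG l) y) :
    blockProj l * x = blockProj l * y := by
  have key : ∀ x y, RingConGen.Rel (BlockRel 3 3 3 (blockG l)) x y →
      blockProj l * x = blockProj l * y := by
    intro x y h
    induction h with
    | of x y h =>
      cases h
      have := eigenProj_mul_right blockC_injective.injOn aeval_C l
      rw [Bar.G, mul_add]
      change blockProj l * Bar.C = _ at this
      rw [this, ← Algebra.commutes, ← Algebra.commutes, ← Algebra.smul_def, ← Algebra.smul_def]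
      change blockC l • blockProj l + _ = _
      rw [← add_smul]
      congr 1
      simp [blockC]
    | refl => rfl
    | symm _ ih => exact ih.symm
    | trans _ _ ih1 ih2 => exact ih1.trans ih2
    | add _ _ ih1 ih2 => rw [mul_add, mul_add, ih1, ih2]
    -- Centrality moves the idempotent next to the second factor.
    | mul _ _ ih1 ih2 =>
      rw [← mul_assoc, ih1, blockProj_comm, mul_assoc, ih2, ← mul_assoc, ← blockProj_comm, mul_assoc]
  apply key
  have h' : RingQuot.mkRingHom (BlockRel 3 3 3 (blockG l)) x =
      RingQuot.mkRingHom (BlockRel 3 3 3 (blockG l)) y := by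
    rw [← RingQuot.mkAlgHom_coe ℂ]; exact h
  rw [RingQuot.mkRingHom_def] at h'
  rw [← RingQuot.eqvGen_rel_eq]
  exact Quot.eqvGen_exact (congrArg RingQuot.toQuot h')

theorem mk_blocks_bijective :
    Function.Bijective fun (x : Bar 3 3 3) (l : Fin 5) => Block.mk 3 3 3 (blockG l) x := by
  constructor
  · intro x y h
    rw [← one_mul x, ← one_mul y, ← sum_blockProj, Finset.sum_mul, Finset.sum_mul]
    exact Finset.sum_congr rfl fun l _ => blockProj_mul_eq_of_mk_eq (congrFun h l)
  · intro z
    choose y hy using fun l => Block.mk_surjective (blockG l) (z l)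
    refine ⟨∑ l, blockProj l * y l, funext fun m => ?_⟩
    dsimp only
    rw [map_sum, Finset.sum_eq_single m]
    · rw [map_mul, mk_blockProj, if_pos rfl, one_mul, hy]
    · intro l _ hl
      rw [map_mul, mk_blockProj, if_neg hl, zero_mul]
    · intro h; exact absurd (Finset.mem_univ m) h

/-- The quotiented Racah algebra is a product of matrix algebras. -/
noncomputable def barEquiv :
    Bar 3 3 3 ≃ₐ[ℂ] (∀ l : Fin 5, Matrix (Fin (mult l)) (Fin (mult l)) ℂ) :=
  AlgEquiv.ofBijective (AlgHom.pi barRep) <| by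
    have h : (fun x l => barRep l x) = (fun (z : ∀ l, Block 3 3 3 (blockG l)) l => blockRep l (z l)) ∘
        fun (x : Bar 3 3 3) (l : Fin 5) => Block.mk 3 3 3 (blockG l) x := by
      funext x l
      exact (blockRep_mk l x).symm
    change Function.Bijective fun x l => barRep l x
    rw [h]
    exact (Function.Bijective.piMap blockRep_bijective).comp mk_blocks_bijective

theorem finrank_bar : Module.finrank ℂ (Bar 3 3 3) = 34 := by
  rw [barEquiv.toLinearEquiv.finrank_eq, Module.finrank_pi_fintype]
  simp only [Module.finrank_matrix, Module.finrank_self, Fintype.card_fin, mul_one]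
  decide

theorem G_mem_center : (Bar.G : Bar 3 3 3) ∈ Subalgebra.center ℂ (Bar 3 3 3) := by
  refine Subalgebra.add_mem _ ?_ (Subalgebra.algebraMap_mem _ _)
  rw [Subalgebra.mem_center_iff]
  exact fun x => (Bar.C_central x).symm

end Decomposition

/-! ### One-site operators on the tensor product, in a form that can be evaluated. -/

section Sites

/-- The action of an endomorphism on the first tensor factor. -/
noncomputable def site₁ : Matrix (Fin 4) (Fin 4) ℂ →ₐ[ℂ] EndTensor 3 3 3 :=
  AlgHom.ofLinearMap
    { toFun := fun X => X ⊗ₖ ((1 : Matrix (Fin 4) (Fin 4) ℂ) ⊗ₖ (1 : Matrix (Fin 4) (Fin 4) ℂ))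
      map_add' := fun X Y => Matrix.add_kronecker X Y _
      map_smul' := fun c X => Matrix.smul_kronecker c X _ }
    (by simp) (fun X Y => by simp [← Matrix.mul_kronecker_mul])

/-- The action of an endomorphism on the second tensor factor. -/
noncomputable def site₂ : Matrix (Fin 4) (Fin 4) ℂ →ₐ[ℂ] EndTensor 3 3 3 :=
  AlgHom.ofLinearMap
    { toFun := fun X => (1 : Matrix (Fin 4) (Fin 4) ℂ) ⊗ₖ (X ⊗ₖ (1 : Matrix (Fin 4) (Fin 4) ℂ))
      map_add' := fun X Y => by rw [Matrix.add_kronecker, Matrix.kronecker_add]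
      map_smul' := fun c X => by
        rw [Matrix.smul_kronecker, Matrix.kronecker_smul, RingHom.id_apply] }
    (by simp) (fun X Y => by simp [← Matrix.mul_kronecker_mul])

/-- The action of an endomorphism on the third tensor factor. -/
noncomputable def site₃ : Matrix (Fin 4) (Fin 4) ℂ →ₐ[ℂ] EndTensor 3 3 3 :=
  AlgHom.ofLinearMap
    { toFun := fun X => (1 : Matrix (Fin 4) (Fin 4) ℂ) ⊗ₖ ((1 : Matrix (Fin 4) (Fin 4) ℂ) ⊗ₖ X)
      map_add' := fun X Y => by rw [Matrix.kronecker_add, Matrix.kronecker_add]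
      map_smul' := fun c X => by
        rw [Matrix.kronecker_smul, Matrix.kronecker_smul, RingHom.id_apply] }
    (by simp) (fun X Y => by simp [← Matrix.mul_kronecker_mul])

theorem site₁_apply (X : Matrix (Fin 4) (Fin 4) ℂ) : site₁ X =
    X ⊗ₖ ((1 : Matrix (Fin 4) (Fin 4) ℂ) ⊗ₖ (1 : Matrix (Fin 4) (Fin 4) ℂ)) := rfl

theorem site₂_apply (X : Matrix (Fin 4) (Fin 4) ℂ) : site₂ X =
    (1 : Matrix (Fin 4) (Fin 4) ℂ) ⊗ₖ (X ⊗ₖ (1 : Matrix (Fin 4) (Fin 4) ℂ)) := rfl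

theorem site₃_apply (X : Matrix (Fin 4) (Fin 4) ℂ) : site₃ X =
    (1 : Matrix (Fin 4) (Fin 4) ℂ) ⊗ₖ ((1 : Matrix (Fin 4) (Fin 4) ℂ) ⊗ₖ X) := rfl

theorem commute_site₁_site₂ (X Y : Matrix (Fin 4) (Fin 4) ℂ) : Commute (site₁ X) (site₂ Y) := by
  rw [Commute, SemiconjBy, site₁_apply, site₂_apply]
  simp only [← Matrix.mul_kronecker_mul, one_mul, mul_one]

theorem commute_site₁_site₃ (X Y : Matrix (Fin 4) (Fin 4) ℂ) : Commute (site₁ X) (site₃ Y) := by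
  rw [Commute, SemiconjBy, site₁_apply, site₃_apply]
  simp only [← Matrix.mul_kronecker_mul, one_mul, mul_one]

theorem commute_site₂_site₃ (X Y : Matrix (Fin 4) (Fin 4) ℂ) : Commute (site₂ X) (site₃ Y) := by
  rw [Commute, SemiconjBy, site₂_apply, site₃_apply]
  simp only [← Matrix.mul_kronecker_mul, one_mul, mul_one]

/-- A rational tensor as a complex vector. -/
noncomputable def ofRat (w : ℕ → ℕ → ℕ → ℚ) : Fin 4 × Fin 4 × Fin 4 → ℂ :=
  fun t => (w t.1 t.2.1 t.2.2 : ℂ)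

theorem ofRat_add (v w : ℕ → ℕ → ℕ → ℚ) : ofRat (v + w) = ofRat v + ofRat w := by
  funext t; simp [ofRat]

theorem ofRat_smul (c : ℚ) (w : ℕ → ℕ → ℕ → ℚ) : ofRat (c • w) = (c : ℂ) • ofRat w := by
  funext t; simp [ofRat]

theorem ofRat_sum {n : ℕ} (w : Fin n → ℕ → ℕ → ℕ → ℚ) :
    ofRat (∑ q, w q) = ∑ q, ofRat (w q) := by
  funext t; simp [ofRat]

theorem ofRat_congr {v w : ℕ → ℕ → ℕ → ℚ} (h : ∀ i j k : Fin 4, v i j k = w i j k) :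
    ofRat v = ofRat w := by
  funext t; simp [ofRat, h]

/-- `op` computes the action of the matrix `X` on rational vectors. -/
def Computes (X : Matrix (Fin 4) (Fin 4) ℂ) (op : (ℕ → ℚ) → ℕ → ℚ) : Prop :=
  ∀ x : ℕ → ℚ, X.mulVec (fun i : Fin 4 => (x i : ℂ)) = fun i : Fin 4 => (op x i : ℂ)

variable {X : Matrix (Fin 4) (Fin 4) ℂ} {op : (ℕ → ℚ) → ℕ → ℚ} (h : Computes X op)
  (w : ℕ → ℕ → ℕ → ℚ)
include h

theorem site₁_mulVec : (site₁ X).mulVec (ofRat w) =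
    ofRat fun i j k => op (fun i => w i j k) i := by
  funext ⟨i, j, k⟩
  have := congrFun (h fun i => w i j k) i
  simp only [Matrix.mulVec, dotProduct] at this
  simp only [site₁_apply, Matrix.mulVec, dotProduct, Fintype.sum_prod_type,
    Matrix.kroneckerMap_apply, Matrix.one_apply, ofRat, ← this]
  simp

theorem site₂_mulVec : (site₂ X).mulVec (ofRat w) =
    ofRat fun i j k => op (fun j => w i j k) j := by
  funext ⟨i, j, k⟩
  have := congrFun (h fun j => w i j k) j
  simp only [Matrix.mulVec, dotProduct] at this
  simp only [site₂_apply, Matrix.mulVec, dotProduct, Fintype.sum_prod_type,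
    Matrix.kroneckerMap_apply, Matrix.one_apply, ofRat, ← this]
  simp

theorem site₃_mulVec : (site₃ X).mulVec (ofRat w) =
    ofRat fun i j k => op (fun k => w i j k) k := by
  funext ⟨i, j, k⟩
  have := congrFun (h fun k => w i j k) k
  simp only [Matrix.mulVec, dotProduct] at this
  simp only [site₃_apply, Matrix.mulVec, dotProduct, Fintype.sum_prod_type,
    Matrix.kroneckerMap_apply, Matrix.one_apply, ofRat, ← this]
  simp

end Sites

/-! ### The table of highest weight vectors. -/

section Tables

/-- The raising operator on rational vectors. -/
def raisingQ (x : ℕ → ℚ) (i : ℕ) : ℚ := if i < 3 then (i + 1) * x (i + 1) else 0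

/-- The lowering operator on rational vectors. -/
def loweringQ (x : ℕ → ℚ) (i : ℕ) : ℚ := if 0 < i then (4 - i) * x (i - 1) else 0

/-- The weight operator on rational vectors. -/
def weightQ (x : ℕ → ℚ) (i : ℕ) : ℚ := (3 - 2 * i) * x i

theorem computes_raising : Computes (raising 3) raisingQ := by
  intro x; funext i
  fin_cases i <;> simp [Matrix.mulVec, dotProduct, raising, raisingQ, Fin.sum_univ_succ]
  norm_num

theorem computes_lowering : Computes (lowering 3) loweringQ := by
  intro x; funext i
  fin_cases i <;> simp [Matrix.mulVec, dotProduct, lowering, loweringQ, Fin.sum_univ_succ] <;>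
    norm_num

theorem computes_weight : Computes (weight 3) weightQ := by
  intro x; funext i
  fin_cases i <;> simp [Matrix.mulVec_diagonal, weight, weightQ]

/-- A one-site operator on the first factor. -/
def on₁ (op : (ℕ → ℚ) → ℕ → ℚ) (w : ℕ → ℕ → ℕ → ℚ) : ℕ → ℕ → ℕ → ℚ :=
  fun i j k => op (fun i => w i j k) i

/-- A one-site operator on the second factor. -/
def on₂ (op : (ℕ → ℚ) → ℕ → ℚ) (w : ℕ → ℕ → ℕ → ℚ) : ℕ → ℕ → ℕ → ℚ :=
  fun i j k => op (fun j => w i j k) j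

/-- A one-site operator on the third factor. -/
def on₃ (op : (ℕ → ℚ) → ℕ → ℚ) (w : ℕ → ℕ → ℕ → ℚ) : ℕ → ℕ → ℕ → ℚ :=
  fun i j k => op (fun k => w i j k) k

/-- The Casimir operator built from raising, lowering and weight operators. -/
def casimirQ (e f h : (ℕ → ℕ → ℕ → ℚ) → ℕ → ℕ → ℕ → ℚ) (w : ℕ → ℕ → ℕ → ℚ) : ℕ → ℕ → ℕ → ℚ :=
  (1 / 2 : ℚ) • (e (f w) + f (e w)) + (1 / 4 : ℚ) • h (h w)

/-- Coordinates of the highest weight vectors; the entry `4 * i + j` of the row `(l, q)` is the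
coefficient of `e_i ⊗ e_j ⊗ e_(l - i - j)`. -/
def highestTable : ℕ → ℕ → List ℤ
  | 0, 0 => [1, 0, 0, 0, 0, 0, 0, 0, 0, 0, 0, 0, 0, 0, 0, 0]
  | 1, 0 => [0, -2, 0, 0, 2, 0, 0, 0, 0, 0, 0, 0, 0, 0, 0, 0]
  | 1, 1 => [-6, 3, 0, 0, 3, 0, 0, 0, 0, 0, 0, 0, 0, 0, 0, 0]
  | 2, 0 => [0, 0, 5, 0, 0, -10, 0, 0, 5, 0, 0, 0, 0, 0, 0, 0]
  | 2, 1 => [0, 30, -15, 0, -30, 0, 0, 0, 15, 0, 0, 0, 0, 0, 0, 0]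
  | 2, 2 => [60, -60, 12, 0, -60, 36, 0, 0, 12, 0, 0, 0, 0, 0, 0, 0]
  | 3, 0 => [0, 0, 0, -10, 0, 0, 30, 0, 0, -30, 0, 0, 10, 0, 0, 0]
  | 3, 1 => [0, 0, -90, 45, 0, 180, -45, 0, -90, -45, 0, 0, 45, 0, 0, 0]
  | 3, 2 => [0, -360, 360, -60, 360, 0, -180, 0, -360, 180, 0, 0, 60, 0, 0, 0]
  | 3, 3 => [-360, 540, -216, 18, 540, -648, 162, 0, -216, 162, 0, 0, 18, 0, 0, 0]
  | 4, 0 => [0, 0, 1, -1, 0, -2, 1, 1, 1, 1, -2, 0, -1, 1, 0, 0]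
  | 4, 1 => [0, 2, -3, 1, -2, 0, 3, -1, 3, -3, 0, 0, -1, 1, 0, 0]
  | _, _ => []

/-- The highest weight vectors of weight `9 - 2 * l`. -/
def highestQ (l q i j k : ℕ) : ℚ :=
  if i + j + k = l then ((highestTable l q).getD (4 * i + j) 0 : ℚ) else 0

theorem raising_highestQ : ∀ l : Fin 5, ∀ q : Fin (mult l), ∀ i j k : Fin 4,
    (on₁ raisingQ (highestQ l q) + on₂ raisingQ (highestQ l q) + on₃ raisingQ (highestQ l q)) i j k
      = 0 := by
  decide +kernel

theorem weight_highestQ : ∀ l : Fin 5, ∀ q : Fin (mult l), ∀ i j k : Fin 4,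
    (on₁ weightQ (highestQ l q) + on₂ weightQ (highestQ l q) + on₃ weightQ (highestQ l q)) i j k
      = ((9 - 2 * l : ℕ) : ℚ) * highestQ l q i j k := by
  decide +kernel

theorem K₁₂_highestQ : ∀ l : Fin 5, ∀ q : Fin (mult l), ∀ i j k : Fin 4,
    casimirQ (fun w => on₁ raisingQ w + on₂ raisingQ w) (fun w => on₁ loweringQ w + on₂ loweringQ w)
      (fun w => on₁ weightQ w + on₂ weightQ w) (highestQ l q) i j k
      = (∑ p : Fin (mult l), blockA l p q • highestQ l p) i j k := by
  decide +kernel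

/-- This fixes the scaling of the table: the subdiagonal of `blockB` consists of ones, so within a
block each vector is determined by the earlier ones. -/
theorem K₂₃_highestQ : ∀ l : Fin 5, ∀ q : Fin (mult l), ∀ i j k : Fin 4,
    casimirQ (fun w => on₂ raisingQ w + on₃ raisingQ w) (fun w => on₂ loweringQ w + on₃ loweringQ w)
      (fun w => on₂ weightQ w + on₃ weightQ w) (highestQ l q) i j k
      = (∑ p : Fin (mult l), blockB l p q • highestQ l p) i j k := by
  decide +kernel

theorem highestQ_ne_zero : ∀ l : Fin 5, ∀ q : Fin (mult l), ∃ i j k : Fin 4,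
    highestQ l q i j k ≠ 0 := by
  decide +kernel

end Tables

/-! ### Casimir elements in terms of raising, lowering and weight operators. -/

section Casimir

variable {R : Type*} [Ring R] [Algebra ℂ R]

/-- The `sl₂` commutation relations, allowing the trivial representation. -/
structure SlTriple (e f h : R) : Prop where
  ef : e * f - f * e = h
  he : h * e - e * h = (2 : ℂ) • e
  hf : h * f - f * h = -(2 : ℂ) • f

/-- The Casimir element of an `sl₂`-triple. -/
noncomputable def casimir (e f h : R) : R :=
  (1 / 2 : ℂ) • (e * f + f * e) + (1 / 4 : ℂ) • (h * h)

theorem sum_sq_eq_casimir (e f h : R) (x : Fin 3 → R)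
    (hx : x = ![(1 / 2 : ℂ) • (e + f), (-Complex.I / 2) • (e - f), (1 / 2 : ℂ) • h]) :
    ∑ a, x a ^ 2 = casimir e f h := by
  have hI : (-Complex.I / 2) ^ 2 = -(1 / 4) := by
    ring_nf; rw [Complex.I_sq]; norm_num
  subst hx
  simp only [Fin.sum_univ_three, Matrix.cons_val_zero, Matrix.cons_val_one, Matrix.cons_val,
    smul_pow, hI]
  simp only [pow_two, casimir, mul_add, add_mul, mul_sub, sub_mul]
  module

namespace SlTriple

variable {e f h : R} (t : SlTriple e f h)
include t

theorem casimir_commute_f : Commute (casimir e f h) f := by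
  have h1 : e * f = f * e + h := by rw [← t.ef]; abel
  have h2 : h * f = f * h - (2 : ℂ) • f := by
    have := t.hf; rw [sub_eq_iff_eq_add] at this; rw [this]; module
  have h2' (x : R) : h * (f * x) = f * (h * x) - (2 : ℂ) • (f * x) := by
    rw [← mul_assoc, h2, sub_mul, mul_assoc, smul_mul_assoc]
  rw [Commute, SemiconjBy, casimir]
  simp only [add_mul, mul_add, smul_mul_assoc, mul_smul_comm, mul_assoc, h1, h2, h2', mul_sub]
  module

theorem add {e' f' h' : R} (t' : SlTriple e' f' h') (hef : Commute e f')
    (hfe : Commute f e') (heh : Commute e h') (hhe : Commute h e') (hfh : Commute f h')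
    (hhf : Commute h f') : SlTriple (e + e') (f + f') (h + h') where
  ef := by
    rw [← t.ef, ← t'.ef]
    simp only [mul_add, add_mul, hef.eq, hfe.eq]
    abel
  he := by
    rw [smul_add, ← t.he, ← t'.he]
    simp only [mul_add, add_mul, hhe.eq, heh.eq]
    abel
  hf := by
    rw [smul_add, ← t.hf, ← t'.hf]
    simp only [mul_add, add_mul, hhf.eq, hfh.eq]
    abel

theorem map {R' : Type*} [Ring R'] [Algebra ℂ R'] (φ : R →ₐ[ℂ] R') :
    SlTriple (φ e) (φ f) (φ h) where
  ef := by rw [← t.ef]; simp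
  he := by rw [← map_smul, ← t.he]; simp
  hf := by rw [← map_smul, ← t.hf]; simp

end SlTriple

theorem casimir_commute_of_commute {e f h x : R} (he : Commute e x) (hf : Commute f x)
    (hh : Commute h x) : Commute (casimir e f h) x :=
  (((he.mul_left hf).add_left (hf.mul_left he)).smul_left _).add_left
    ((hh.mul_left hh).smul_left _)

theorem slTriple_spin : SlTriple (raising 3) (lowering 3) (weight 3) := by
  constructor
  · ext i j
    fin_cases i <;> fin_cases j <;>
      simp [raising, lowering, weight, Matrix.mul_apply, Fin.sum_univ_succ] <;> norm_num
  · ext i j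
    fin_cases i <;> fin_cases j <;>
      simp [raising, weight, Matrix.mul_apply, Fin.sum_univ_succ] <;> norm_num
  · ext i j
    fin_cases i <;> fin_cases j <;>
      simp [lowering, weight, Matrix.mul_apply, Fin.sum_univ_succ] <;> norm_num

/-- The total raising operator. -/
noncomputable def totalE : EndTensor 3 3 3 :=
  site₁ (raising 3) + site₂ (raising 3) + site₃ (raising 3)

/-- The total lowering operator. -/
noncomputable def totalF : EndTensor 3 3 3 :=
  site₁ (lowering 3) + site₂ (lowering 3) + site₃ (lowering 3)

/-- The total weight operator. -/
noncomputable def totalH : EndTensor 3 3 3 :=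
  site₁ (weight 3) + site₂ (weight 3) + site₃ (weight 3)

theorem slTriple₁₂ : SlTriple (site₁ (raising 3) + site₂ (raising 3))
    (site₁ (lowering 3) + site₂ (lowering 3)) (site₁ (weight 3) + site₂ (weight 3)) := by
  refine (slTriple_spin.map site₁).add (slTriple_spin.map site₂) ?_ ?_ ?_ ?_ ?_ ?_ <;>
    exact commute_site₁_site₂ _ _

theorem slTriple₂₃ : SlTriple (site₂ (raising 3) + site₃ (raising 3))
    (site₂ (lowering 3) + site₃ (lowering 3)) (site₂ (weight 3) + site₃ (weight 3)) := by
  refine (slTriple_spin.map site₂).add (slTriple_spin.map site₃) ?_ ?_ ?_ ?_ ?_ ?_ <;>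
    exact commute_site₂_site₃ _ _

theorem slTriple_total : SlTriple totalE totalF totalH := by
  refine slTriple₁₂.add (slTriple_spin.map site₃) ?_ ?_ ?_ ?_ ?_ ?_ <;>
    exact (commute_site₁_site₃ _ _).add_left (commute_site₂_site₃ _ _)

theorem spin₁_eq (a : Fin 3) : spin₁ 3 3 3 a = site₁ (spin 3 a) := rfl
theorem spin₂_eq (a : Fin 3) : spin₂ 3 3 3 a = site₂ (spin 3 a) := rfl
theorem spin₃_eq (a : Fin 3) : spin₃ 3 3 3 a = site₃ (spin 3 a) := rfl

theorem K₁₂_eq : K₁₂ 3 3 3 = casimir (site₁ (raising 3) + site₂ (raising 3))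
    (site₁ (lowering 3) + site₂ (lowering 3)) (site₁ (weight 3) + site₂ (weight 3)) := by
  refine sum_sq_eq_casimir _ _ _ _ ?_
  funext a
  rw [spin₁_eq, spin₂_eq]
  fin_cases a <;> simp only [spin, Fin.zero_eta, Fin.mk_one, Fin.reduceFinMk, Matrix.cons_val,
    map_smul, map_add, map_sub] <;> module

theorem K₂₃_eq : K₂₃ 3 3 3 = casimir (site₂ (raising 3) + site₃ (raising 3))
    (site₂ (lowering 3) + site₃ (lowering 3)) (site₂ (weight 3) + site₃ (weight 3)) := by
  refine sum_sq_eq_casimir _ _ _ _ ?_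
  funext a
  rw [spin₂_eq, spin₃_eq]
  fin_cases a <;> simp only [spin, Fin.zero_eta, Fin.mk_one, Fin.reduceFinMk, Matrix.cons_val,
    map_smul, map_add, map_sub] <;> module

theorem total_spin_eq : (fun a : Fin 3 => spin₁ 3 3 3 a + spin₂ 3 3 3 a + spin₃ 3 3 3 a) =
    ![(1 / 2 : ℂ) • (totalE + totalF), (-Complex.I / 2) • (totalE - totalF),
      (1 / 2 : ℂ) • totalH] := by
  funext a
  rw [spin₁_eq, spin₂_eq, spin₃_eq]
  fin_cases a <;> simp only [spin, Fin.zero_eta, Fin.mk_one, Fin.reduceFinMk, Matrix.cons_val,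
    map_smul, map_add, map_sub, totalE, totalF, totalH] <;> module

theorem K₁₂₃_eq : K₁₂₃ 3 3 3 = casimir totalE totalF totalH :=
  sum_sq_eq_casimir _ _ _ _ total_spin_eq

theorem K₁₂_commute_totalF : Commute (K₁₂ 3 3 3) totalF := by
  rw [K₁₂_eq, totalF]
  refine slTriple₁₂.casimir_commute_f.add_right (casimir_commute_of_commute ?_ ?_ ?_) <;>
    exact (commute_site₁_site₃ _ _).add_left (commute_site₂_site₃ _ _)

theorem K₂₃_commute_totalF : Commute (K₂₃ 3 3 3) totalF := by
  rw [K₂₃_eq, totalF, add_assoc]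
  refine (casimir_commute_of_commute ?_ ?_ ?_).add_right slTriple₂₃.casimir_commute_f <;>
    exact (commute_site₁_site₂ _ _).symm.add_left (commute_site₁_site₃ _ _).symm

/-- The operators `totalE`, `totalF`, `totalH` and the three total spin components span the same
space. -/
theorem mem_spinCentralizer_iff {X : EndTensor 3 3 3} : X ∈ spinCentralizer 3 3 3 ↔
    Commute totalE X ∧ Commute totalF X ∧ Commute totalH X := by
  have hE : totalE = (spin₁ 3 3 3 0 + spin₂ 3 3 3 0 + spin₃ 3 3 3 0)
      + Complex.I • (spin₁ 3 3 3 1 + spin₂ 3 3 3 1 + spin₃ 3 3 3 1) := by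
    have h0 := congrFun total_spin_eq 0
    have h1 := congrFun total_spin_eq 1
    rw [h0, h1]
    simp only [Matrix.cons_val_zero, Matrix.cons_val_one, smul_smul]
    have : Complex.I * (-Complex.I / 2) = 1 / 2 := by
      ring_nf; rw [Complex.I_sq]; norm_num
    rw [this]; module
  have hF : totalF = (spin₁ 3 3 3 0 + spin₂ 3 3 3 0 + spin₃ 3 3 3 0)
      - Complex.I • (spin₁ 3 3 3 1 + spin₂ 3 3 3 1 + spin₃ 3 3 3 1) := by
    have h0 := congrFun total_spin_eq 0
    have h1 := congrFun total_spin_eq 1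
    rw [h0, h1]
    simp only [Matrix.cons_val_zero, Matrix.cons_val_one, smul_smul]
    have : Complex.I * (-Complex.I / 2) = 1 / 2 := by
      ring_nf; rw [Complex.I_sq]; norm_num
    rw [this]; module
  have hH : totalH = (2 : ℂ) • (spin₁ 3 3 3 2 + spin₂ 3 3 3 2 + spin₃ 3 3 3 2) := by
    have h0 := congrFun total_spin_eq 2
    rw [h0]
    simp only [Matrix.cons_val, smul_smul]
    norm_num
  rw [spinCentralizer, Subalgebra.mem_centralizer_iff]
  constructor
  · intro h
    have h' (a : Fin 3) : Commute (spin₁ 3 3 3 a + spin₂ 3 3 3 a + spin₃ 3 3 3 a) X := h _ ⟨a, rfl⟩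
    rw [hE, hF, hH]
    exact ⟨(h' 0).add_left ((h' 1).smul_left _), (h' 0).sub_left ((h' 1).smul_left _),
      (h' 2).smul_left _⟩
  · rintro ⟨h1, h2, h3⟩ _ ⟨a, rfl⟩
    have := congrFun total_spin_eq a
    dsimp only at this ⊢
    rw [this]
    fin_cases a
    · exact (h1.add_left h2).smul_left _
    · exact (h1.sub_left h2).smul_left _
    · exact h3.smul_left _

end Casimir

/-! ### Transfer of the table to complex vectors. -/

section HighestWeightVectors

/-- The highest weight vectors as complex vectors. -/
noncomputable def highest (l : Fin 5) (q : Fin (mult l)) : Fin 4 × Fin 4 × Fin 4 → ℂ :=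
  ofRat (highestQ l q)

theorem casimir_mulVec {e f h : EndTensor 3 3 3} {e' f' h' : (ℕ → ℕ → ℕ → ℚ) → ℕ → ℕ → ℕ → ℚ}
    (he : ∀ w, e.mulVec (ofRat w) = ofRat (e' w)) (hf : ∀ w, f.mulVec (ofRat w) = ofRat (f' w))
    (hh : ∀ w, h.mulVec (ofRat w) = ofRat (h' w)) (w : ℕ → ℕ → ℕ → ℚ) :
    (casimir e f h).mulVec (ofRat w) = ofRat (casimirQ e' f' h' w) := by
  simp only [casimir, casimirQ, Matrix.add_mulVec, Matrix.smul_mulVec, ← Matrix.mulVec_mulVec, he,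
    hf, hh, ofRat_add, ofRat_smul]
  norm_num

theorem two_sites_mulVec {X Y : EndTensor 3 3 3} {x y : (ℕ → ℕ → ℕ → ℚ) → ℕ → ℕ → ℕ → ℚ}
    (hx : ∀ w, X.mulVec (ofRat w) = ofRat (x w)) (hy : ∀ w, Y.mulVec (ofRat w) = ofRat (y w))
    (w : ℕ → ℕ → ℕ → ℚ) : (X + Y).mulVec (ofRat w) = ofRat (x w + y w) := by
  rw [Matrix.add_mulVec, hx, hy, ofRat_add]

theorem totalE_highest (l : Fin 5) (q : Fin (mult l)) : totalE.mulVec (highest l q) = 0 := by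
  rw [totalE, highest, two_sites_mulVec (two_sites_mulVec (site₁_mulVec computes_raising)
    (site₂_mulVec computes_raising)) (site₃_mulVec computes_raising)]
  refine (ofRat_congr (w := 0) fun i j k => ?_).trans (funext fun t => by simp [ofRat])
  exact raising_highestQ l q i j k

theorem totalH_highest (l : Fin 5) (q : Fin (mult l)) :
    totalH.mulVec (highest l q) = ((9 - 2 * l : ℕ) : ℂ) • highest l q := by
  rw [totalH, highest, two_sites_mulVec (two_sites_mulVec (site₁_mulVec computes_weight)
    (site₂_mulVec computes_weight)) (site₃_mulVec computes_weight),
    ← Rat.cast_natCast, ← ofRat_smul]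
  exact ofRat_congr (weight_highestQ l q)

theorem K₁₂_highest (l : Fin 5) (q : Fin (mult l)) :
    (K₁₂ 3 3 3).mulVec (highest l q) = ∑ p, (blockA l p q : ℂ) • highest l p := by
  rw [K₁₂_eq, highest, casimir_mulVec
    (two_sites_mulVec (site₁_mulVec computes_raising) (site₂_mulVec computes_raising))
    (two_sites_mulVec (site₁_mulVec computes_lowering) (site₂_mulVec computes_lowering))
    (two_sites_mulVec (site₁_mulVec computes_weight) (site₂_mulVec computes_weight))]
  simp only [highest, ← ofRat_smul, ← ofRat_sum]
  exact ofRat_congr (K₁₂_highestQ l q)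

theorem K₂₃_highest (l : Fin 5) (q : Fin (mult l)) :
    (K₂₃ 3 3 3).mulVec (highest l q) = ∑ p, (blockB l p q : ℂ) • highest l p := by
  rw [K₂₃_eq, highest, casimir_mulVec
    (two_sites_mulVec (site₂_mulVec computes_raising) (site₃_mulVec computes_raising))
    (two_sites_mulVec (site₂_mulVec computes_lowering) (site₃_mulVec computes_lowering))
    (two_sites_mulVec (site₂_mulVec computes_weight) (site₃_mulVec computes_weight))]
  simp only [highest, ← ofRat_smul, ← ofRat_sum]
  exact ofRat_congr (K₂₃_highestQ l q)

theorem highest_ne_zero (l : Fin 5) (q : Fin (mult l)) : highest l q ≠ 0 := by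
  obtain ⟨i, j, k, h⟩ := highestQ_ne_zero l q
  intro h0
  have := congrFun h0 (i, j, k)
  simp only [highest, ofRat, Pi.zero_apply, Rat.cast_eq_zero] at this
  exact h this

end HighestWeightVectors

/-! ### The basis of lowered highest weight vectors. -/

section WeightBasis

attribute [local instance] LieRing.ofAssociativeRing

/-- The underlying space of the threefold tensor product. -/
abbrev Tensor : Type := Fin 4 × Fin 4 × Fin 4 → ℂ

/-- Matrices as endomorphisms. -/
noncomputable abbrev toEnd : EndTensor 3 3 3 ≃ₐ[ℂ] Module.End ℂ Tensor :=
  Matrix.toLinAlgEquiv'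

theorem toEnd_apply (X : EndTensor 3 3 3) (v : Tensor) : toEnd X v = X.mulVec v := rfl

/-- The highest weight `9 - 2 * l` of the constituents in block `l`. -/
def topWeight (l : Fin 5) : ℕ := 9 - 2 * l

theorem isSl2Triple : IsSl2Triple (toEnd totalH) (toEnd totalE) (toEnd totalF) where
  h_ne_zero h := by
    have := totalH_highest 0 ⟨0, by decide⟩
    rw [← toEnd_apply, h, LinearMap.zero_apply, eq_comm, smul_eq_zero] at this
    rcases this with h | h
    · norm_num at h
    · exact highest_ne_zero 0 _ h
  lie_e_f := by rw [Ring.lie_def, ← map_mul, ← map_mul, ← map_sub, slTriple_total.ef]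
  lie_h_e_nsmul := by
    rw [Ring.lie_def, ← map_mul, ← map_mul, ← map_sub, slTriple_total.he, map_smul]
    module
  lie_h_f_nsmul := by
    rw [Ring.lie_def, ← map_mul, ← map_mul, ← map_sub, slTriple_total.hf, map_smul]
    module

theorem hasPrimitiveVector (l : Fin 5) (q : Fin (mult l)) :
    isSl2Triple.HasPrimitiveVectorWith (highest l q) (topWeight l : ℂ) where
  ne_zero := highest_ne_zero l q
  lie_h := totalH_highest l q
  lie_e := totalE_highest l q

/-- Indices of the weight basis: a block, an intermediate spin, and a weight. -/
abbrev Index : Type := Σ l : Fin 5, Fin (mult l) × Fin (topWeight l + 1)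

/-- The vectors obtained from the highest weight vectors by lowering. -/
noncomputable def lowered (l : Fin 5) (q : Fin (mult l)) (m : ℕ) : Tensor :=
  (toEnd totalF ^ m) (highest l q)

theorem lowered_zero (l : Fin 5) (q : Fin (mult l)) : lowered l q 0 = highest l q := rfl

theorem totalF_lowered (l : Fin 5) (q : Fin (mult l)) (m : ℕ) :
    toEnd totalF (lowered l q m) = lowered l q (m + 1) := by
  rw [lowered, lowered, pow_succ', Module.End.mul_apply]

theorem totalH_lowered (l : Fin 5) (q : Fin (mult l)) (m : ℕ) :
    toEnd totalH (lowered l q m) = ((topWeight l : ℂ) - 2 * m) • lowered l q m :=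
  (hasPrimitiveVector l q).lie_h_pow_toEnd_f m

theorem totalE_lowered_succ (l : Fin 5) (q : Fin (mult l)) (m : ℕ) :
    toEnd totalE (lowered l q (m + 1)) =
      (((m : ℂ) + 1) * ((topWeight l : ℂ) - m)) • lowered l q m :=
  (hasPrimitiveVector l q).lie_e_pow_succ_toEnd_f m

theorem totalE_lowered_zero (l : Fin 5) (q : Fin (mult l)) :
    toEnd totalE (lowered l q 0) = 0 :=
  totalE_highest l q

theorem lowered_eq_zero (l : Fin 5) (q : Fin (mult l)) : lowered l q (topWeight l + 1) = 0 :=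
  (hasPrimitiveVector l q).pow_toEnd_f_eq_zero_of_eq_nat rfl

theorem lowered_ne_zero (l : Fin 5) (q : Fin (mult l)) :
    ∀ m, m ≤ topWeight l → lowered l q m ≠ 0
  | 0, _ => highest_ne_zero l q
  | m + 1, h => fun h0 => by
    have h1 := totalE_lowered_succ l q m
    rw [h0, map_zero, eq_comm, smul_eq_zero] at h1
    refine h1.elim (mul_ne_zero ?_ ?_) (lowered_ne_zero l q m (by omega))
    · exact_mod_cast m.succ_ne_zero
    · rw [sub_ne_zero]; norm_cast; omega

theorem toEnd_lowered_of_commute {X : EndTensor 3 3 3} (hX : Commute X totalF) {l : Fin 5}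
    {q : Fin (mult l)} {y : Fin (mult l) → ℂ}
    (h : toEnd X (highest l q) = ∑ p, y p • highest l p) (m : ℕ) :
    toEnd X (lowered l q m) = ∑ p, y p • lowered l p m := by
  have h1 : toEnd X * toEnd totalF ^ m = toEnd totalF ^ m * toEnd X := by
    rw [← map_pow, ← map_mul, (hX.pow_right m).eq, map_mul]
  rw [lowered, ← Module.End.mul_apply, h1, Module.End.mul_apply, h, map_sum]
  simp only [map_smul]
  rfl

theorem K₁₂_lowered (l : Fin 5) (q : Fin (mult l)) (m : ℕ) :
    toEnd (K₁₂ 3 3 3) (lowered l q m) = ∑ p, (blockA l p q : ℂ) • lowered l p m :=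
  toEnd_lowered_of_commute K₁₂_commute_totalF (K₁₂_highest l q) m

theorem K₂₃_lowered (l : Fin 5) (q : Fin (mult l)) (m : ℕ) :
    toEnd (K₂₃ 3 3 3) (lowered l q m) = ∑ p, (blockB l p q : ℂ) • lowered l p m :=
  toEnd_lowered_of_commute K₂₃_commute_totalF (K₂₃_highest l q) m

theorem blockC_eq (l : Fin 5) : blockC l = (topWeight l : ℂ) / 2 + (topWeight l : ℂ) ^ 2 / 4 := by
  have : ∀ l : Fin 5, blockG l - 1 / 4 = (topWeight l : ℚ) / 2 + (topWeight l : ℚ) ^ 2 / 4 := by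
    decide +kernel
  have := congrArg (Rat.cast (K := ℂ)) (this l)
  push_cast at this
  exact this

theorem K₁₂₃_lowered (l : Fin 5) (q : Fin (mult l)) (m : ℕ) :
    toEnd (K₁₂₃ 3 3 3) (lowered l q m) = blockC l • lowered l q m := by
  have hc : Commute (K₁₂₃ 3 3 3) totalF := by
    rw [K₁₂₃_eq]; exact slTriple_total.casimir_commute_f
  have h0 : toEnd (K₁₂₃ 3 3 3) (highest l q) =
      ∑ p, (if p = q then blockC l else 0) • highest l p := by
    have h1 := totalE_lowered_succ l q 0
    rw [zero_add, ← totalF_lowered, lowered_zero] at h1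
    have h2 : toEnd totalE (highest l q) = 0 := totalE_highest l q
    have h3 := totalH_lowered l q 0
    rw [lowered_zero] at h3
    -- On a vector of weight λ killed by `totalE`, the product `totalE * totalF` acts by λ, and the
    -- Casimir by λ/2 + λ²/4.
    rw [K₁₂₃_eq, casimir]
    simp only [map_add, map_smul, map_mul, LinearMap.add_apply, LinearMap.smul_apply,
      Module.End.mul_apply, h1, h2, h3, map_zero, ite_smul, zero_smul, Finset.sum_ite_eq',
      Finset.mem_univ, if_true, blockC_eq]
    push_cast
    module
  rw [toEnd_lowered_of_commute hc h0]
  simp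

/-- Distinguishes the vectors of the weight basis. -/
def label (i : Index) : ℚ :=
  blockA i.1 i.2.1 i.2.1 + 100 * (blockG i.1 - 1 / 4)
    + 10000 * ((topWeight i.1 : ℚ) - 2 * ((i.2.2 : ℕ) : ℚ))

theorem label_injective : Function.Injective label := by
  have h : (Finset.univ.image label).card = (Finset.univ : Finset Index).card := by decide +kernel
  exact fun i j hij => Finset.card_image_iff.1 h (Finset.mem_univ i) (Finset.mem_univ j) hij

theorem blockA_eq_zero (l : Fin 5) {p q : Fin (mult l)} (h : p ≠ q) : blockA l p q = 0 := by
  rw [blockA, Matrix.diagonal_apply_ne _ h]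

theorem K₁₂_lowered' (l : Fin 5) (q : Fin (mult l)) (m : ℕ) :
    toEnd (K₁₂ 3 3 3) (lowered l q m) = (blockA l q q : ℂ) • lowered l q m := by
  rw [K₁₂_lowered, Finset.sum_eq_single q]
  · intro p _ h; rw [blockA_eq_zero l h, Rat.cast_zero, zero_smul]
  · intro h; exact absurd (Finset.mem_univ q) h

/-- The vectors are joint eigenvectors of `K₁₂`, `K₁₂₃` and `totalH`. The weights 1, 100, 10000
merge these into one operator whose eigenvalues on the family are pairwise distinct. -/
theorem lowered_linearIndependent :
    LinearIndependent ℂ fun i : Index => lowered i.1 i.2.1 i.2.2 := by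
  refine Module.End.eigenvectors_linearIndependent'
    (toEnd (K₁₂ 3 3 3) + (100 : ℂ) • toEnd (K₁₂₃ 3 3 3) + (10000 : ℂ) • toEnd totalH)
    (fun i : Index => (label i : ℂ)) (fun i j h => label_injective (Rat.cast_injective h)) _ ?_
  intro i
  refine ⟨?_, lowered_ne_zero i.1 i.2.1 i.2.2 (Nat.lt_succ_iff.1 i.2.2.2)⟩
  rw [Module.End.mem_eigenspace_iff, LinearMap.add_apply, LinearMap.add_apply,
    LinearMap.smul_apply, LinearMap.smul_apply, K₁₂_lowered', K₁₂₃_lowered, totalH_lowered, label,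
    blockC]
  push_cast
  module

theorem card_index : Fintype.card Index = 64 := by decide +kernel

/-- The basis of the threefold tensor product by lowered highest weight vectors. -/
noncomputable def weightBasis : Module.Basis Index ℂ Tensor :=
  haveI : Nonempty Index := ⟨⟨0, ⟨0, by decide⟩, 0⟩⟩
  basisOfLinearIndependentOfCardEqFinrank lowered_linearIndependent (by
    rw [card_index]; simp)

theorem weightBasis_apply (l : Fin 5) (q : Fin (mult l)) (m : Fin (topWeight l + 1)) :
    weightBasis ⟨l, q, m⟩ = lowered l q m := by
  simp [weightBasis]

end WeightBasis

/-! ### The centralizer as endomorphisms of the multiplicity spaces. -/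

section BlockAction

theorem lowered_eq_zero_of_lt (l : Fin 5) (q : Fin (mult l)) {m : ℕ} (h : topWeight l < m) :
    lowered l q m = 0 := by
  induction m, h using Nat.le_induction with
  | base => exact lowered_eq_zero l q
  | succ m _ ih => rw [← totalF_lowered, ih, map_zero]

/-- Linear maps that agree on the lowered highest weight vectors are equal. -/
theorem tensor_hom_ext {S T : Module.End ℂ Tensor}
    (h : ∀ l q m, S (lowered l q m) = T (lowered l q m)) : S = T :=
  weightBasis.ext fun ⟨l, q, m⟩ => by rw [weightBasis_apply, h]

/-- Families of matrices act on the tensor product through the intermediate spins. -/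
noncomputable def blockActionLinear :
    (∀ l, Matrix (Fin (mult l)) (Fin (mult l)) ℂ) →ₗ[ℂ] Module.End ℂ Tensor :=
  (weightBasis.constr ℂ).toLinearMap ∘ₗ LinearMap.pi fun i : Index =>
    ∑ p, (LinearMap.toSpanSingleton ℂ Tensor (lowered i.1 p i.2.2)) ∘ₗ
      (LinearMap.proj i.2.1 ∘ₗ LinearMap.proj p ∘ₗ
        (LinearMap.proj i.1 : (∀ l, Fin (mult l) → Fin (mult l) → ℂ) →ₗ[ℂ] _))

theorem blockActionLinear_lowered (Y : ∀ l, Matrix (Fin (mult l)) (Fin (mult l)) ℂ) (l : Fin 5)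
    (q : Fin (mult l)) (m : ℕ) :
    blockActionLinear Y (lowered l q m) = ∑ p, Y l p q • lowered l p m := by
  rcases lt_or_ge (topWeight l) m with h | h
  · simp [lowered_eq_zero_of_lt l _ h]
  · have h1 := weightBasis.constr_basis ℂ
      (fun i : Index => ∑ p, Y i.1 p i.2.1 • lowered i.1 p i.2.2) ⟨l, q, ⟨m, Nat.lt_succ_of_le h⟩⟩
    rw [weightBasis_apply] at h1
    rw [← h1]
    refine congrArg (fun f => weightBasis.constr ℂ f (lowered l q m)) (funext fun i => ?_)
    simp only [LinearMap.pi_apply, LinearMap.sum_apply]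
    rfl

/-- Families of matrices act on the tensor product through the intermediate spins. -/
noncomputable def blockAction :
    (∀ l, Matrix (Fin (mult l)) (Fin (mult l)) ℂ) →ₐ[ℂ] Module.End ℂ Tensor :=
  AlgHom.ofLinearMap blockActionLinear
    (tensor_hom_ext fun l q m => by
      rw [blockActionLinear_lowered]
      simp [Matrix.one_apply])
    (fun Y Z => tensor_hom_ext fun l q m => by
      rw [Module.End.mul_apply]
      simp only [blockActionLinear_lowered, map_sum, map_smul, Pi.mul_apply, Matrix.mul_apply,
        Finset.sum_smul, Finset.smul_sum]
      rw [Finset.sum_comm]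
      simp only [smul_smul, mul_comm])

theorem blockAction_lowered (Y : ∀ l, Matrix (Fin (mult l)) (Fin (mult l)) ℂ) (l : Fin 5)
    (q : Fin (mult l)) (m : ℕ) :
    blockAction Y (lowered l q m) = ∑ p, Y l p q • lowered l p m :=
  blockActionLinear_lowered Y l q m

theorem blockAction_injective : Function.Injective blockAction := by
  rw [injective_iff_map_eq_zero]
  intro Y hY
  funext l
  ext p q
  have h := blockAction_lowered Y l q 0
  rw [hY, LinearMap.zero_apply, eq_comm] at h
  have hl : LinearIndependent ℂ fun p : Fin (mult l) => lowered l p 0 :=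
    lowered_linearIndependent.comp (fun p => (⟨l, p, 0⟩ : Index)) fun p p' h => by simpa using h
  exact Fintype.linearIndependent_iff.1 hl _ h p

/-- `T` moves only the lowering index, with a coefficient independent of `q`, while `blockAction Y`
mixes only the index `q`. -/
theorem blockAction_commute (Y : ∀ l, Matrix (Fin (mult l)) (Fin (mult l)) ℂ)
    {T : Module.End ℂ Tensor} {κ : Fin 5 → ℕ → ℂ} {σ : ℕ → ℕ}
    (hT : ∀ l q m, T (lowered l q m) = κ l m • lowered l q (σ m)) : Commute T (blockAction Y) :=
  tensor_hom_ext fun l q m => by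
    simp only [Module.End.mul_apply, hT, blockAction_lowered, map_sum, map_smul, Finset.smul_sum,
      smul_comm (κ l m)]

theorem blockAction_mem (Y : ∀ l, Matrix (Fin (mult l)) (Fin (mult l)) ℂ) :
    toEnd.symm (blockAction Y) ∈ spinCentralizer 3 3 3 := by
  have key {X : EndTensor 3 3 3} (h : Commute (toEnd X) (blockAction Y)) :
      Commute X (toEnd.symm (blockAction Y)) := by
    have := h.map (toEnd.symm : Module.End ℂ Tensor ≃ₐ[ℂ] EndTensor 3 3 3)
    rwa [AlgEquiv.symm_apply_apply] at this
  rw [mem_spinCentralizer_iff]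
  -- At `m = 0` the truncated subtraction gives 0, which is harmless because the coefficient
  -- vanishes there.
  refine ⟨key (blockAction_commute Y (σ := (· - 1))
      (κ := fun l m => (m : ℂ) * ((topWeight l : ℂ) + 1 - m)) fun l q m => ?_),
    key (blockAction_commute Y (σ := (· + 1)) (κ := fun _ _ => 1) fun l q m => ?_),
    key (blockAction_commute Y (σ := id) (κ := fun l m => (topWeight l : ℂ) - 2 * m)
      fun l q m => ?_)⟩
  · cases m with
    | zero => rw [totalE_lowered_zero, Nat.cast_zero, zero_mul, zero_smul]
    | succ m =>
      rw [totalE_lowered_succ, Nat.add_sub_cancel]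
      push_cast
      congr 1
      ring
  · rw [totalF_lowered, one_smul]
  · exact totalH_lowered l q m

/-- `K₁₂₃` and `totalH` are diagonal in the weight basis; the first eigenvalue selects the block and
the second the unlowered vectors. -/
theorem eq_sum_highest {l : Fin 5} {x : Tensor} (hC : toEnd (K₁₂₃ 3 3 3) x = blockC l • x)
    (hH : toEnd totalH x = (topWeight l : ℂ) • x) :
    ∃ y : Fin (mult l) → ℂ, x = ∑ p, y p • highest l p := by
  have diag {T : Module.End ℂ Tensor} {d : Index → ℂ} {μ : ℂ}
      (hd : ∀ i, T (weightBasis i) = d i • weightBasis i) (hx : T x = μ • x) (i : Index)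
      (hi : d i ≠ μ) : weightBasis.repr x i = 0 := by
    have h1 : T x = ∑ i, (d i * weightBasis.repr x i) • weightBasis i := by
      conv_lhs => rw [← weightBasis.sum_repr x]
      simp only [map_sum, map_smul, hd, smul_smul, mul_comm]
    have h2 := congrArg (fun v => weightBasis.repr v i) (h1.symm.trans hx)
    simp only [weightBasis.repr_sum_self, map_smul, Finsupp.smul_apply, smul_eq_mul] at h2
    exact (mul_eq_mul_right_iff.1 h2).resolve_left hi
  have hzero : ∀ i : Index, (∀ p, i ≠ ⟨l, p, 0⟩) → weightBasis.repr x i = 0 := by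
    rintro ⟨l', q, m⟩ hi
    by_cases hl : l' = l
    · subst hl
      refine diag (d := fun i => (topWeight i.1 : ℂ) - 2 * (i.2.2 : ℕ)) (fun i => ?_) hH _ ?_
      · obtain ⟨l, q, m⟩ := i
        rw [weightBasis_apply, totalH_lowered]
      · intro h
        have hm : m = 0 := by
          rw [sub_eq_self] at h
          ext
          simpa using h
        exact hi q (by rw [hm])
    · refine diag (d := fun i => blockC i.1) (fun i => ?_) hC _ fun h => hl (blockC_injective h)
      obtain ⟨l, q, m⟩ := i
      rw [weightBasis_apply, K₁₂₃_lowered]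
  refine ⟨fun p => weightBasis.repr x ⟨l, p, 0⟩, ?_⟩
  conv_lhs => rw [← weightBasis.sum_repr x]
  have hinj : Function.Injective fun p : Fin (mult l) => (⟨l, p, 0⟩ : Index) :=
    fun p p' h => by simpa using h
  rw [← Fintype.sum_of_injective _ hinj (fun p => weightBasis.repr x ⟨l, p, 0⟩ • highest l p)]
  · intro i hi
    rw [hzero i fun p hp => hi ⟨p, hp.symm⟩, zero_smul]
  · intro p
    rw [weightBasis_apply]
    rfl

/-- `X` commutes with `K₁₂₃` and `totalH`, hence preserves each space of highest weight vectors; as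
it commutes with `totalF`, its matrices there determine it. -/
theorem exists_blockAction_eq {X : EndTensor 3 3 3} (hX : X ∈ spinCentralizer 3 3 3) :
    ∃ Y, blockAction Y = toEnd X := by
  obtain ⟨hE, hF, hH⟩ := mem_spinCentralizer_iff.1 hX
  have hC : Commute (K₁₂₃ 3 3 3) X := by
    rw [K₁₂₃_eq]; exact casimir_commute_of_commute hE hF hH
  have key {Z : EndTensor 3 3 3} (hZ : Commute Z X) {v : Tensor} {μ : ℂ}
      (hv : toEnd Z v = μ • v) : toEnd Z (toEnd X v) = μ • toEnd X v := by
    rw [← Module.End.mul_apply, ← map_mul, hZ.eq, map_mul, Module.End.mul_apply, hv, map_smul]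
  have h (l : Fin 5) (q : Fin (mult l)) :
      ∃ y : Fin (mult l) → ℂ, toEnd X (highest l q) = ∑ p, y p • highest l p :=
    eq_sum_highest (key hC (K₁₂₃_lowered l q 0)) (key hH (totalH_highest l q))
  choose y hy using h
  refine ⟨fun l => Matrix.of fun p q => y l q p, tensor_hom_ext fun l q m => ?_⟩
  rw [blockAction_lowered, toEnd_lowered_of_commute hF.symm (hy l q)]
  rfl

/-- The centralizer as a product of matrix algebras. -/
noncomputable def centralizerEquiv :
    (∀ l, Matrix (Fin (mult l)) (Fin (mult l)) ℂ) ≃ₐ[ℂ] spinCentralizer 3 3 3 :=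
  AlgEquiv.ofBijective
    ((toEnd.symm.toAlgHom.comp blockAction).codRestrict (spinCentralizer 3 3 3) blockAction_mem)
    ⟨fun Y Z h => blockAction_injective (toEnd.symm.injective (congrArg Subtype.val h)),
     fun ⟨X, hX⟩ => by
      obtain ⟨Y, hY⟩ := exists_blockAction_eq hX
      refine ⟨Y, Subtype.ext ?_⟩
      exact (congrArg toEnd.symm hY).trans (toEnd.symm_apply_apply X)⟩

theorem centralizerEquiv_eq {Y : ∀ l, Matrix (Fin (mult l)) (Fin (mult l)) ℂ} {X : EndTensor 3 3 3}
    (h : ∀ l q m, toEnd X (lowered l q m) = ∑ p, Y l p q • lowered l p m) :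
    (centralizerEquiv Y : EndTensor 3 3 3) = X := by
  have : blockAction Y = toEnd X := tensor_hom_ext fun l q m => by rw [blockAction_lowered, h]
  exact (congrArg toEnd.symm this).trans (toEnd.symm_apply_apply X)

end BlockAction

end Racah

/-! ### The isomorphism through the common product of matrix algebras. -/

theorem mainTheorem7 :
    (∃ φ : Racah.Bar 3 3 3 ≃ₐ[ℂ] Racah.spinCentralizer 3 3 3,
      (φ Racah.Bar.A : Racah.EndTensor 3 3 3) = Racah.K₁₂ 3 3 3 ∧
      (φ Racah.Bar.B : Racah.EndTensor 3 3 3) = Racah.K₂₃ 3 3 3 ∧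
      (φ Racah.Bar.C : Racah.EndTensor 3 3 3) = Racah.K₁₂₃ 3 3 3) ∧
    Module.finrank ℂ (Racah.Bar 3 3 3) = 34 ∧
    (Racah.Bar.G : Racah.Bar 3 3 3) ∈ Subalgebra.center ℂ (Racah.Bar 3 3 3) ∧
    Function.Bijective
      (fun (x : Racah.Bar 3 3 3) (i : Fin 5) =>
        Racah.Block.mk 3 3 3 ((![25, 16, 9, 4, 1] : Fin 5 → ℂ) i) x) ∧
    Module.finrank ℂ (Racah.Block 3 3 3 25) = 1 ∧
    Module.finrank ℂ (Racah.Block 3 3 3 16) = 4 ∧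
    Module.finrank ℂ (Racah.Block 3 3 3 9) = 9 ∧
    Module.finrank ℂ (Racah.Block 3 3 3 4) = 16 ∧
    Module.finrank ℂ (Racah.Block 3 3 3 1) = 4 := by
  have hG : (![25, 16, 9, 4, 1] : Fin 5 → ℂ) = fun l => (Racah.blockG l : ℂ) := by
    funext l
    fin_cases l <;> simp [Racah.blockG]
  have hdim (l : Fin 5) :
      Module.finrank ℂ (Racah.Block 3 3 3 ((![25, 16, 9, 4, 1] : Fin 5 → ℂ) l)) =
        Racah.mult l * Racah.mult l := by
    rw [hG]
    exact Racah.finrank_block l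
  refine ⟨⟨Racah.barEquiv.trans Racah.centralizerEquiv, ?_, ?_, ?_⟩, Racah.finrank_bar,
    Racah.G_mem_center, ?_, hdim 0, hdim 1, hdim 2, hdim 3, hdim 4⟩
  · refine Racah.centralizerEquiv_eq fun l q m => ?_
    change _ = ∑ p, Racah.barRep l Racah.Bar.A p q • _
    simp only [Racah.K₁₂_lowered, Racah.barRep_A, Racah.toComplex_apply]
  · refine Racah.centralizerEquiv_eq fun l q m => ?_
    change _ = ∑ p, Racah.barRep l Racah.Bar.B p q • _
    simp only [Racah.K₂₃_lowered, Racah.barRep_B, Racah.toComplex_apply]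
  · refine Racah.centralizerEquiv_eq fun l q m => ?_
    change _ = ∑ p, Racah.barRep l Racah.Bar.C p q • _
    rw [Racah.K₁₂₃_lowered, Racah.barRep_C]
    simp only [Matrix.algebraMap_matrix_apply, ite_smul, zero_smul, Finset.sum_ite_eq',
      Finset.mem_univ, if_true]
    rfl
  · rw [hG]
    exact Racah.mk_blocks_bijective
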